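/- Let $a,b,c$ be positive integers. Consider the hexagon with side lengths $a,b,c,a,b,c$ and all angles $120^\circ$. It is described in the oblique coordinate system with unit vectors $e_1=(\sqrt3/2,-1/2)$ and $e_2=(0,1)$, where it has the successive vertices $$(0,0),\ (b,0),\ (a+b,a),\ (a+b,a+c),\ (a,a+c),\ (0,c),$$ so that the origin is a vertex at which sides of lengths $b$ and $c$ meet and these two sides span the axes. A rhombus tiling of the hexagon is a tiling by rhombi with all sides of length $1$ and angles $60^\circ$ and $120^\circ$, i.e. a partition of the unit triangles of the triangular lattice contained in the hexagon into pairs of triangles sharing an edge. The horizontal rhombus with lowest vertex $(x,y)$ is the unit rhombus with vertices $(x,y)$, $(x+1,y+1)$, $(x,y+1)$, $(x-1,y)$. Let $(x,y)$ be an integer point (in these coordinates) with $0\le x\le a+b-1$ and $1\le y\le a+c-1$. Then the number of rhombus tilings of the hexagon that contain the horizontal rhombus with lowest vertex $(x,y)$ (this number is $0$ if that rhombus is not contained in the hexagon) equals $$\left(\prod_{i=1}^{a}\prod_{j=1}^{b}\prod_{k=1}^{c}\frac{i+j+k-1}{i+j+k-2}\right)\frac{(1)_c}{(b+1)_c} \sum_{n=1}^{a}\sum_{m=1}^{a}\sum_{s=1}^{m}(-1)^{n+s}\binom{c+x-y+n-2}{x-1}\binom{b-x+y+s-1}{b-x+s-1}\frac{(b+1)_{s-1}}{(b+c+1)_{s-1}}\binom{m-1}{s-1}\frac{(c+1)_{n-1}}{(n-1)!}\frac{(b+c+n)_{m-n}}{(m-n)!}.$$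 Here $(z)_k=z(z+1)\cdots(z+k-1)$ for $k\ge1$ and $(z)_0=1$; $\binom{\alpha}{k}=\alpha(\alpha-1)\cdots(\alpha-k+1)/k!$ for every integer $\alpha$ (possibly negative) and every integer $k\ge0$, and $\binom{\alpha}{k}=0$ for $k<0$; and $\frac{(b+c+n)_{m-n}}{(m-n)!}$ is read as $0$ if $m<n$. -/

import Mathlib

/-!
Unit rhombus tilings of the hexagon with side lengths `a, b, c, a, b, c` and all angles `120°`.

Points are written in the oblique coordinate system with unit vectors
`e₁ = (√3/2, -1/2)` and `e₂ = (0, 1)`, whose origin is the vertex of the hexagon at which the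
left vertical side (of length `c`) and the lower left side (of length `b`) meet.  The angle
between `e₁` and `e₂` is `120°`, so `e₁ + e₂ = (√3/2, 1/2)` is a unit vector as well, and the
integer points are the vertices of the triangular lattice with edges `± e₁, ± e₂, ± (e₁ + e₂)`.
-/

namespace RhombusTiling

/-- The point `p` lies in the hexagon whose vertices are, in the oblique coordinates,
`(0,0), (b,0), (a+b,a), (a+b,a+c), (a,a+c), (0,c)`.  Its successive sides have the directions
`e₁, e₁ + e₂, e₂, -e₁, -(e₁ + e₂), -e₂` and the lengths `b, a, c, b, a, c`. -/
abbrev InHexagon (a b c : ℕ) (p : ℤ × ℤ) : Prop :=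
  0 ≤ p.1 ∧ p.1 ≤ a + b ∧ 0 ≤ p.2 ∧ p.2 ≤ a + c ∧ -(b : ℤ) ≤ p.2 - p.1 ∧ p.2 - p.1 ≤ c

/-- The unit triangles of the triangular lattice: the unit parallelogram with
corners `p, p + e₁, p + e₁ + e₂, p + e₂` is cut by its diagonal from `p` to `p + e₁ + e₂` into
the triangle `(p, false)` below and the triangle `(p, true)` above the diagonal. -/
abbrev UnitTriangle : Type := (ℤ × ℤ) × Bool

/-- The three vertices of a unit triangle. -/
def UnitTriangle.vertices : UnitTriangle → Finset (ℤ × ℤ)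
  | ((x, y), false) => {(x, y), (x + 1, y), (x + 1, y + 1)}
  | ((x, y), true) => {(x, y), (x, y + 1), (x + 1, y + 1)}

/-- The unit triangles that make up the hexagon. -/
noncomputable def hexagonTriangles (a b c : ℕ) : Finset UnitTriangle :=
  ((Finset.Icc (0 : ℤ) (a + b) ×ˢ Finset.Icc (0 : ℤ) (a + c)) ×ˢ Finset.univ).filter
    fun t => ∀ p ∈ UnitTriangle.vertices t, InHexagon a b c p

/-- The unit rhombi (with angles `60°` and `120°`) contained in the hexagon.  A rhombus is
recorded as the set of the two unit triangles it consists of; these share an edge, that is,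
they have exactly two vertices in common. -/
noncomputable def hexagonRhombi (a b c : ℕ) : Finset (Finset UnitTriangle) :=
  ((hexagonTriangles a b c).powersetCard 2).filter fun r =>
    ∀ t ∈ r, ∀ u ∈ r, t ≠ u →
      (UnitTriangle.vertices t ∩ UnitTriangle.vertices u).card = 2

/-- The rhombus tilings of the hexagon: the sets of rhombi contained in the hexagon that cover
every unit triangle of the hexagon exactly once. -/
noncomputable def tilings (a b c : ℕ) : Finset (Finset (Finset UnitTriangle)) :=
  (hexagonRhombi a b c).powerset.filter fun T =>
    ∀ t ∈ hexagonTriangles a b c, (T.filter fun r => t ∈ r).card = 1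

/-- The horizontal rhombus (the one whose longer diagonal is horizontal) with lowest vertex
`(x, y)`.  Its left, lowest, right and uppermost vertices are
`(x - 1, y), (x, y), (x + 1, y + 1), (x, y + 1)`; its shorter, vertical diagonal cuts it into
the triangles with vertices `(x - 1, y), (x, y), (x, y + 1)` and
`(x, y), (x, y + 1), (x + 1, y + 1)`. -/
def horizontalRhombus (x y : ℤ) : Finset UnitTriangle :=
  {((x - 1, y), false), ((x, y), true)}

/-- The number of rhombus tilings of the hexagon that contain the horizontal rhombus with
lowest vertex `(x, y)`. -/
noncomputable def numTilingsContaining (a b c : ℕ) (x y : ℤ) : ℕ :=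
  ((tilings a b c).filter fun T => horizontalRhombus x y ∈ T).card

/-- The binomial coefficient `α (α - 1) ⋯ (α - k + 1) / k!` for integers `α` and `k ≥ 0`, where
`α` may be negative; it is zero for `k < 0`. -/
def binom (α k : ℤ) : ℤ :=
  if k < 0 then 0 else Ring.choose α k.toNat

/-- The Pochhammer symbol `(z)_k = z (z + 1) ⋯ (z + k - 1)`, with `(z)_0 = 1`. -/
noncomputable def poch (z : ℚ) (k : ℕ) : ℚ :=
  (ascPochhammer ℚ k).eval z

/-- The quotient `(z)_k / k!` for an integer `k`; it is zero for `k < 0`, in accordance with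
`1 / k! = 0` for negative integers `k`. -/
noncomputable def pochDivFactorial (z : ℚ) (k : ℤ) : ℚ :=
  if k < 0 then 0 else poch z k.toNat / (k.toNat.factorial : ℚ)

end RhombusTiling

/-!
Follow a tiling from the lower right side of the hexagon to the upper left one, both of length `a`:
the rhombi that are not cut by a diagonal edge form `a` non-intersecting lattice paths, and every
such family of paths comes from exactly one tiling. By the Lindström–Gessel–Viennot lemma the
number of tilings is the determinant of the matrix `M` of path numbers.

Horizontal rhombi are the down steps of the paths. Forbidding one of them subtracts from `M` the
rank-one matrix `u vᵀ`, where `u` and `v` count the paths up to and from that step. By the matrix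
determinant lemma the number of tilings that contain the rhombus is
`det M - det (M - u vᵀ) = det M · vᵀ M⁻¹ u`. Multiplication by Pascal matrices turns the entries of
`M` into binomial coefficients `(b + c + s + n).choose (b + s)`, and two explicit triangular
matrices reduce the result to a scalar matrix; this gives `det M`, which is MacMahon's product, and
`M⁻¹`.

If the rhombus lies outside the hexagon there is no such step, but then `u` or `v` is `0` or the
product of `M` with an explicit vector whose support is disjoint from that of the other one.
-/

namespace RhombusTiling

open Finset Matrix

theorem binom_of_neg (α : ℤ) {k : ℤ} (hk : k < 0) : binom α k = 0 := if_pos hk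

theorem binom_natCast (n k : ℕ) : binom n k = n.choose k := by
  simp [binom, Ring.choose_natCast]

theorem binom_of_lt {n : ℕ} {k : ℤ} (hk : (n : ℤ) < k) : binom n k = 0 := by
  lift k to ℕ using by omega
  rw [binom_natCast, Nat.choose_eq_zero_of_lt (by omega), Nat.cast_zero]

theorem binom_zero_right (α : ℤ) : binom α 0 = 1 := by simp [binom]

theorem binom_zero_left (k : ℤ) : binom 0 k = if k = 0 then 1 else 0 := by
  split_ifs with h
  · rw [h, binom_zero_right]
  · rcases lt_or_gt_of_ne h with h | h
    · exact binom_of_neg _ h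
    · exact binom_of_lt (n := 0) h

theorem binom_succ (α k : ℤ) : binom (α + 1) k = binom α (k - 1) + binom α k := by
  rcases lt_trichotomy k 0 with h | rfl | h
  · rw [binom_of_neg _ h, binom_of_neg _ h, binom_of_neg _ (by omega), add_zero]
  · rw [binom_zero_right, binom_zero_right, binom_of_neg _ (by omega), zero_add]
  · obtain ⟨m, rfl⟩ : ∃ m : ℕ, k = m + 1 := ⟨(k - 1).toNat, by omega⟩
    have hm : ((m : ℤ) + 1).toNat = m + 1 := by omega
    simp [binom, hm, Ring.choose_succ_succ, show ¬ ((m : ℤ) + 1 < 0) by omega]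

section LatticePaths

variable {α ι : Type*} {step : ℕ → α → Finset α} {n : ℕ}

/-- The number of lattice paths with `n` steps from `x` to `e`, where `step t x` is the set of
positions that a path may take at time `t + 1` if it is at `x` at time `t`. -/
def pathCount [DecidableEq α] : (ℕ → α → Finset α) → ℕ → α → α → ℕ
  | _, 0, x, e => if x = e then 1 else 0
  | step, n + 1, x, e => ∑ x' ∈ step 0 x, pathCount (fun t => step (t + 1)) n x' e

variable [LinearOrder α] [LinearOrder ι]

/-- `s t j` is the position at time `t` of the `j`-th path of a family of non-intersecting lattice
paths with `n` steps that leads from `u` to `v`.  The paths are kept constant from time `n` on, so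
that a family is determined by its function `s`. -/
structure IsPathFamily (step : ℕ → α → Finset α) (n : ℕ) (u v : ι → α) (s : ℕ → ι → α) :
    Prop where
  start : s 0 = u
  eq_end : ∀ t, n ≤ t → s t = v
  step : ∀ t < n, ∀ j, s (t + 1) j ∈ step t (s t j)
  strictMono : ∀ t, StrictMono (s t)

namespace IsPathFamily

variable {u u' v : ι → α} {s : ℕ → ι → α}

theorem tail (hs : IsPathFamily step (n + 1) u v s) :
    IsPathFamily (fun t => step (t + 1)) n (s 1) v fun t => s (t + 1) where
  start := rfl
  eq_end t ht := hs.eq_end _ (by omega)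
  step t ht := hs.step _ (by omega)
  strictMono t := hs.strictMono _

theorem cons (hs : IsPathFamily (fun t => step (t + 1)) n u' v s) (hu : StrictMono u)
    (h : ∀ j, u' j ∈ step 0 (u j)) :
    IsPathFamily step (n + 1) u v fun t => t.casesOn u s where
  start := rfl
  eq_end
    | 0, ht => absurd ht (by omega)
    | t + 1, ht => hs.eq_end t (by omega)
  step
    | 0, _ => fun j => show s 0 j ∈ step 0 (u j) from hs.start.symm ▸ h j
    | t + 1, ht => hs.step t (by omega)
  strictMono
    | 0 => hu
    | t + 1 => hs.strictMono t

theorem zero_iff (hu : StrictMono u) : IsPathFamily step 0 u v s ↔ u = v ∧ s = fun _ => v := by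
  refine ⟨fun hs => ?_, ?_⟩
  · have hsv : s = fun _ => v := funext fun t => hs.eq_end t t.zero_le
    exact ⟨by rw [← hs.start, hsv], hsv⟩
  · rintro ⟨rfl, rfl⟩
    exact ⟨rfl, fun _ _ => rfl, fun t ht => absurd ht t.not_lt_zero, fun _ => hu⟩

theorem isEmpty_of_not_strictMono (hu : ¬ StrictMono u) :
    IsEmpty {s // IsPathFamily step n u v s} :=
  ⟨fun s => hu (s.2.start ▸ s.2.strictMono 0)⟩

theorem natCard_zero (hu : StrictMono u) [Decidable (u = v)] :
    Nat.card {s // IsPathFamily step 0 u v s} = if u = v then 1 else 0 := by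
  simp only [zero_iff hu]
  split_ifs with h <;> simp [h]

/-- The decomposition of a family of paths into its first steps and the remaining family. -/
def succEquiv [Fintype ι] (step : ℕ → α → Finset α) (n : ℕ) (v : ι → α) (hu : StrictMono u) :
    {s // IsPathFamily step (n + 1) u v s} ≃
      Σ u' : Fintype.piFinset fun j => step 0 (u j),
        {s // IsPathFamily (fun t => step (t + 1)) n u'.1 v s} where
  toFun s := ⟨⟨s.1 1, Fintype.mem_piFinset.2 fun j => by
    simpa only [s.2.start] using s.2.step 0 n.succ_pos j⟩, fun t => s.1 (t + 1), s.2.tail⟩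
  invFun p := ⟨fun t => t.casesOn u p.2.1, p.2.2.cons hu (Fintype.mem_piFinset.1 p.1.2)⟩
  left_inv s := Subtype.ext <| funext fun t => by cases t with
    | zero => exact s.2.start.symm
    | succ t => rfl
  right_inv := by
    rintro ⟨⟨u', hu'⟩, s, hs⟩
    obtain rfl := hs.start
    rfl

protected theorem finite [Finite ι] (step : ℕ → α → Finset α) (n : ℕ) (u v : ι → α) :
    Finite {s // IsPathFamily step n u v s} := by
  cases nonempty_fintype ι
  by_cases hu : StrictMono u
  · induction n generalizing step u with
    | zero =>
      simp only [zero_iff hu]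
      exact ((Set.finite_singleton fun _ => v).subset fun s hs => hs.2).to_subtype
    | succ n ih =>
      have (u' : ι → α) : Finite {s // IsPathFamily (fun t => step (t + 1)) n u' v s} := by
        by_cases hu' : StrictMono u'
        · exact ih _ _ hu'
        · exact @Finite.of_subsingleton _ (isEmpty_of_not_strictMono hu').instSubsingleton
      exact Finite.of_equiv _ (succEquiv step n v hu).symm
  · exact @Finite.of_subsingleton _ (isEmpty_of_not_strictMono hu).instSubsingleton

theorem natCard_succ [Fintype ι] (hu : StrictMono u) :
    Nat.card {s // IsPathFamily step (n + 1) u v s} =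
      ∑ u' ∈ Fintype.piFinset fun j => step 0 (u j),
        Nat.card {s // IsPathFamily (fun t => step (t + 1)) n u' v s} := by
  have := fun u' : ι → α => IsPathFamily.finite (fun t => step (t + 1)) n u' v
  rw [Nat.card_congr (succEquiv step n v hu), Nat.card_sigma,
    Finset.sum_coe_sort (Fintype.piFinset fun j => step 0 (u j)) fun u' =>
      Nat.card {s // IsPathFamily (fun t => step (t + 1)) n u' v s}]

end IsPathFamily

/-- The matrix of path numbers from the points `u i` to the points `v j`. -/
def pathCountMatrix (R : Type*) [NatCast R] (step : ℕ → α → Finset α) (n : ℕ) (u v : ι → α) :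
    Matrix ι ι R :=
  of fun i j => (pathCount step n (u i) (v j) : R)

variable (R : Type*) [CommRing R] [Fintype ι] {u v : ι → α}

theorem det_pathCountMatrix_zero (hu : StrictMono u) (hv : StrictMono v) :
    (pathCountMatrix R step 0 u v).det = if u = v then 1 else 0 := by
  split_ifs with h
  · subst h
    rw [← det_one (n := ι)]
    congr 1
    ext i j
    simp [pathCountMatrix, pathCount, one_apply, hu.injective.eq_iff]
  · obtain ⟨i, hi⟩ : ∃ i, ∀ j, u i ≠ v j := by
      by_contra! hex
      choose f hf using hex
      have hfu : u = v ∘ f := funext hf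
      have hf_surj : f.Surjective := Finite.injective_iff_surjective.1
        (Function.Injective.of_comp (hfu ▸ hu.injective))
      exact h ((hu.range_inj hv).1 (hfu ▸ hf_surj.range_comp v))
    exact det_eq_zero_of_row_eq_zero i fun j => by simp [pathCountMatrix, pathCount, hi]

theorem det_pathCountMatrix_succ :
    (pathCountMatrix R step (n + 1) u v).det =
      ∑ u' ∈ Fintype.piFinset fun j => step 0 (u j),
        (pathCountMatrix R (fun t => step (t + 1)) n u' v).det := by
  have hrows : pathCountMatrix R step (n + 1) u v = fun i => ∑ x ∈ step 0 (u i),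
      fun j => (pathCount (fun t => step (t + 1)) n x (v j) : R) := by
    ext i j
    simp [pathCountMatrix, pathCount, Finset.sum_apply]
  rw [hrows]
  exact (detRowAlternating (R := R) (n := ι)).toMultilinearMap.map_sum_finset
    (fun _ x j => (pathCount (fun t => step (t + 1)) n x (v j) : R)) fun i => step 0 (u i)

/-- The Lindström–Gessel–Viennot lemma -/
theorem natCard_isPathFamily_eq_det
    (hstep : ∀ t x y, x < y → ∀ x' ∈ step t x, ∀ y' ∈ step t y, x' ≤ y')
    (hu : StrictMono u) (hv : StrictMono v) :
    (Nat.card {s // IsPathFamily step n u v s} : R) = (pathCountMatrix R step n u v).det := by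
  induction n generalizing step u with
  | zero => rw [IsPathFamily.natCard_zero hu, det_pathCountMatrix_zero R hu hv, Nat.cast_ite,
      Nat.cast_one, Nat.cast_zero]
  | succ n ih =>
    rw [IsPathFamily.natCard_succ hu, det_pathCountMatrix_succ, Nat.cast_sum]
    refine Finset.sum_congr rfl fun u' hu' => ?_
    by_cases hmono : StrictMono u'
    · exact ih (fun t => hstep (t + 1)) hmono
    · have := IsPathFamily.isEmpty_of_not_strictMono (step := fun t => step (t + 1)) (n := n)
        (v := v) hmono
      -- Two paths that meet contribute two equal rows.
      obtain ⟨i, j, hij, hji⟩ : ∃ i j, i < j ∧ u' j ≤ u' i := by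
        simpa only [StrictMono, not_forall, not_lt, exists_prop] using hmono
      have hrow : u' i = u' j := le_antisymm
        (hstep 0 _ _ (hu hij) _ (Fintype.mem_piFinset.1 hu' i) _ (Fintype.mem_piFinset.1 hu' j)) hji
      rw [Nat.card_of_isEmpty, Nat.cast_zero]
      exact (det_zero_of_row_eq hij.ne <| funext fun k => by
        simp only [pathCountMatrix, of_apply, hrow]).symm

end LatticePaths

section UnitSteps

/-- The steps of the paths of a rhombus tiling: a path keeps its position or moves down by one. -/
def unitSteps : ℕ → ℤ → Finset ℤ := fun _ x => {x, x - 1}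

/-- The unit steps with the exception of the down step from `x₀` between the times `t₀` and
`t₀ + 1`. -/
def unitStepsAvoiding (t₀ : ℕ) (x₀ : ℤ) : ℕ → ℤ → Finset ℤ :=
  fun t x => if t = t₀ ∧ x = x₀ then {x} else {x, x - 1}

theorem mem_unitSteps {t : ℕ} {x x' : ℤ} : x' ∈ unitSteps t x ↔ x' = x ∨ x' = x - 1 := by
  simp [unitSteps]

theorem mem_unitStepsAvoiding {t₀ t : ℕ} {x₀ x x' : ℤ} :
    x' ∈ unitStepsAvoiding t₀ x₀ t x ↔
      x' ∈ unitSteps t x ∧ ¬ (t = t₀ ∧ x = x₀ ∧ x' = x₀ - 1) := by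
  rw [unitStepsAvoiding, mem_unitSteps]
  split_ifs with h <;> simp only [mem_singleton, mem_insert] <;> omega

theorem le_of_mem_unitSteps (t : ℕ) (x y : ℤ) (hxy : x < y) :
    ∀ x' ∈ unitSteps t x, ∀ y' ∈ unitSteps t y, x' ≤ y' := by
  simp only [mem_unitSteps]
  omega

theorem pathCount_unitSteps_succ (n : ℕ) (x e : ℤ) :
    pathCount unitSteps (n + 1) x e =
      pathCount unitSteps n x e + pathCount unitSteps n (x - 1) e :=
  sum_pair (by omega)

theorem pathCount_unitSteps (n : ℕ) (x e : ℤ) :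
    (pathCount unitSteps n x e : ℤ) = binom n (x - e) := by
  induction n generalizing x with
  | zero => simp [pathCount, binom_zero_left, sub_eq_zero]
  | succ n ih =>
    rw [pathCount_unitSteps_succ, Nat.cast_add, ih, ih, Nat.cast_succ, binom_succ, add_comm,
      sub_right_comm]

theorem pathCount_unitStepsAvoiding (t₀ m : ℕ) (x₀ x e : ℤ) :
    (pathCount (unitStepsAvoiding t₀ x₀) (t₀ + 1 + m) x e : ℤ) =
      binom (t₀ + 1 + m : ℕ) (x - e) - binom t₀ (x - x₀) * binom m (x₀ - 1 - e) := by
  induction t₀ generalizing x with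
  | zero =>
    have hcount : (pathCount (unitStepsAvoiding 0 x₀) (m + 1) x e : ℤ) =
        pathCount unitSteps (m + 1) x e -
          if x = x₀ then (pathCount unitSteps m (x₀ - 1) e : ℤ) else 0 := by
      have htail : (fun t => unitStepsAvoiding 0 x₀ (t + 1)) = unitSteps := by
        ext; simp [unitStepsAvoiding, unitSteps]
      rw [pathCount_unitSteps_succ, pathCount, htail, unitStepsAvoiding]
      split_ifs with h h' h'
      · rw [sum_singleton, h', Nat.cast_add, add_sub_cancel_right]
      · exact absurd h.2 h'
      · exact absurd ⟨rfl, h'⟩ h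
      · rw [sum_pair (by omega), Nat.cast_add, sub_zero]
    rw [zero_add, add_comm 1 m, hcount, pathCount_unitSteps, pathCount_unitSteps, Nat.cast_zero,
      binom_zero_left]
    simp [sub_eq_zero]
  | succ t₀ ih =>
    have htail : (fun t => unitStepsAvoiding (t₀ + 1) x₀ (t + 1)) = unitStepsAvoiding t₀ x₀ := by
      ext; simp [unitStepsAvoiding]
    rw [show t₀ + 1 + 1 + m = t₀ + 1 + m + 1 by omega, pathCount, htail, unitStepsAvoiding,
      if_neg (by omega), sum_pair (by omega), Nat.cast_add, ih, ih, Nat.cast_succ,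
      Nat.cast_succ, binom_succ, binom_succ, sub_right_comm x 1, sub_right_comm x 1]
    ring

end UnitSteps

section BinomialSums

variable {R : Type*} [CommRing R] {a n x₀ : ℕ}

theorem sum_binom_mul_of_recurrence {G : ℕ → ℕ → R}
    (hG : ∀ n x, G (n + 1) x = G n x + G n (x + 1)) (h : x₀ + n < a) :
    ∑ j : Fin a, (binom n ((j : ℕ) - x₀) : R) * G 0 j = G n x₀ := by
  induction n generalizing x₀ with
  | zero =>
    rw [sum_eq_single_of_mem ⟨x₀, h⟩ (mem_univ _)]
    · simp [binom_zero_right]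
    · intro j _ hj
      have hj : (j : ℕ) ≠ x₀ := fun hjx => hj (Fin.ext hjx)
      rw [Nat.cast_zero, binom_zero_left, if_neg (by omega), Int.cast_zero, zero_mul]
  | succ n ih =>
    rw [hG, ← ih (by omega), ← ih (by omega), ← sum_add_distrib]
    refine sum_congr rfl fun j _ => ?_
    rw [Nat.cast_succ, binom_succ, Nat.cast_succ, sub_sub]
    push_cast
    ring

theorem sum_binom_mul_binom_sub (h : x₀ + n < a) (α β : ℤ) :
    ∑ j : Fin a, (binom n ((j : ℕ) - x₀) : R) * binom α (β - (j : ℕ)) =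
      binom (α + n) (β - x₀) := by
  have key := sum_binom_mul_of_recurrence
    (G := fun n x => (binom (α + n) (β - x) : R)) (fun n x => ?_) h
  · simpa only [Nat.cast_zero, add_zero] using key
  · rw [Nat.cast_succ, ← add_assoc, binom_succ, Nat.cast_succ, sub_sub, add_comm, Int.cast_add]

theorem sum_binom_mul_binom_add (h : x₀ + n < a) (α β : ℤ) :
    ∑ j : Fin a, (binom n ((j : ℕ) - x₀) : R) * binom α (β + (j : ℕ)) =
      binom (α + n) (β + x₀ + n) := by
  have key := sum_binom_mul_of_recurrence
    (G := fun n x => (binom (α + n) (β + x + n) : R)) (fun n x => ?_) h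
  · simpa only [Nat.cast_zero, add_zero] using key
  · rw [Nat.cast_succ, ← add_assoc, ← add_assoc, binom_succ, Nat.cast_succ, add_sub_cancel_right,
      Int.cast_add]
    ring_nf

theorem sum_binom_mul_neg_one_pow_mul_binom (h : x₀ + n < a) (α k : ℤ) :
    ∑ j : Fin a, (binom n ((j : ℕ) - x₀) : R) * ((-1) ^ (j : ℕ) * binom (α + (j : ℕ)) k) =
      (-1) ^ (n + x₀) * binom (α + x₀) (k - n) := by
  have key := sum_binom_mul_of_recurrence
    (G := fun n x => (-1) ^ (n + x) * (binom (α + x) (k - n) : R)) (fun n x => ?_) h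
  · simpa only [Nat.cast_zero, zero_add, sub_zero] using key
  · rw [Nat.cast_succ, Nat.cast_succ, ← add_assoc α, binom_succ (α + x), ← sub_sub k]
    push_cast
    ring

theorem choose_mul_choose_eq_choose_mul_binom (d p n m : ℕ) :
    ((d + p).choose (d + n) * (d + n).choose (d + m) : R) =
      (d + p).choose (d + m) * binom (p - m : ℕ) (n - m) := by
  rcases lt_or_ge n m with hn | hn
  · rw [binom_of_neg _ (by omega), Nat.choose_eq_zero_of_lt (show d + n < d + m by omega)]
    simp
  · rw [← Nat.cast_sub hn, binom_natCast, ← Nat.cast_mul, Nat.choose_mul (by omega),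
      Nat.add_sub_add_left, Nat.add_sub_add_left, Nat.cast_mul, Int.cast_natCast]

theorem sum_neg_one_pow_mul_choose_mul_choose (d m : ℕ) (p : Fin a) :
    ∑ n : Fin a, (-1 : R) ^ (n : ℕ) * ((d + p).choose (d + n) * (d + n).choose (d + m)) =
      if m = p then (-1) ^ m else 0 := by
  simp only [choose_mul_choose_eq_choose_mul_binom]
  rcases lt_or_ge (p : ℕ) m with h | h
  · rw [if_neg h.ne', Nat.choose_eq_zero_of_lt (show d + p < d + m by omega)]
    simp
  · have key := sum_binom_mul_neg_one_pow_mul_binom (R := R) (a := a) (n := p - m) (x₀ := m)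
      (by omega) 0 0
    simp only [binom_zero_right, Int.cast_one, mul_one] at key
    simp only [mul_left_comm _ ((d + p).choose (d + m) : R), mul_comm ((-1 : R) ^ _)]
    rw [← mul_sum, key]
    split_ifs with hmp
    · simp [hmp, binom_zero_right]
    · rw [binom_of_neg _ (by omega)]
      simp

theorem binom_add_sub (d n m : ℕ) :
    binom (d + n : ℕ) (n - m) = (d + n).choose (d + m) := by
  rcases lt_or_ge n m with h | h
  · rw [binom_of_neg _ (by omega), Nat.choose_eq_zero_of_lt (by omega), Nat.cast_zero]
  · rw [← Nat.cast_sub h, binom_natCast,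
      ← Nat.choose_symm_of_eq_add (show d + n = (d + m) + (n - m) by omega)]

end BinomialSums

section Pochhammer

theorem poch_natCast_succ (m k : ℕ) :
    poch ((m : ℚ) + 1) k = ((m + k).factorial : ℚ) / m.factorial := by
  rw [poch, ← Nat.cast_succ, ascPochhammer_nat_eq_natCast_ascFactorial, eq_div_iff (by positivity),
    ← Nat.factorial_mul_ascFactorial m k]
  push_cast
  ring

theorem pochDivFactorial_natCast_succ (m p n : ℕ) :
    pochDivFactorial ((m : ℚ) + n + 1) ((p : ℤ) - n) = ((m + p).choose (m + n) : ℚ) := by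
  rw [pochDivFactorial]
  split_ifs with h
  · rw [Nat.choose_eq_zero_of_lt (by omega), Nat.cast_zero]
  · obtain ⟨d, rfl⟩ := Nat.exists_eq_add_of_le (show n ≤ p by omega)
    rw [Nat.cast_add, add_sub_cancel_left, Int.toNat_natCast, ← Nat.cast_add, poch_natCast_succ,
      ← add_assoc, Nat.cast_add_choose]
    field_simp

theorem poch_one_div_poch (b c : ℕ) :
    poch 1 c / poch ((b : ℚ) + 1) c = (b.factorial * c.factorial : ℚ) / (b + c).factorial := by
  have h := poch_natCast_succ 0 c
  rw [Nat.cast_zero, zero_add, zero_add, Nat.factorial_zero, Nat.cast_one, div_one] at h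
  rw [h, poch_natCast_succ]
  field_simp

end Pochhammer

section PathMatrix

/-- The numbers of lattice paths with `b + c` unit steps between the two sides of length `a` of the
hexagon. -/
noncomputable def pathMatrix (a b c : ℕ) : Matrix (Fin a) (Fin a) ℚ :=
  of fun i j => (binom ((b : ℤ) + c) ((b : ℤ) + (i : ℕ) - (j : ℕ)) : ℚ)

/-- The lower triangular Pascal matrix; multiplication by it from the left, and by its transpose
from the right, makes the entries of the path matrix quotients of factorials. -/
noncomputable def pascalMatrix (a : ℕ) : Matrix (Fin a) (Fin a) ℚ :=
  of fun s i => (binom (s : ℕ) (i : ℕ) : ℚ)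

/-- The lower triangular matrix that takes the path matrix, multiplied by the Pascal matrices, to
an upper triangular one. -/
noncomputable def leftFactor (a b c : ℕ) : Matrix (Fin a) (Fin a) ℚ :=
  of fun m s => (-1 : ℚ) ^ (s : ℕ) * (poch ((b : ℚ) + 1) s / poch ((b : ℚ) + c + 1) s) *
    ((m : ℕ).choose s : ℚ)

/-- The lower triangular matrix whose transpose is, up to a scalar, the inverse of the upper
triangular matrix obtained by multiplication with `leftFactor`. -/
noncomputable def rightFactor (a b c : ℕ) : Matrix (Fin a) (Fin a) ℚ :=
  of fun m n => (-1 : ℚ) ^ (n : ℕ) * (poch ((c : ℚ) + 1) n / ((n : ℕ).factorial : ℚ)) *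
    pochDivFactorial ((b : ℚ) + c + (n : ℕ) + 1) ((m : ℕ) - (n : ℕ) : ℤ)

variable (a b c : ℕ)

theorem leftFactor_apply (m s : Fin a) :
    leftFactor a b c m s = (-1 : ℚ) ^ (s : ℕ) *
      (((b + s).factorial : ℚ) / b.factorial / ((b + c + s).factorial / (b + c).factorial)) *
      ((m : ℕ).choose s : ℚ) := by
  rw [leftFactor, of_apply, poch_natCast_succ, ← Nat.cast_add b c, poch_natCast_succ]

theorem rightFactor_apply (m n : Fin a) :
    rightFactor a b c m n = (-1 : ℚ) ^ (n : ℕ) *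
      (((c + n).factorial : ℚ) / c.factorial / (n : ℕ).factorial) *
      ((b + c + m).choose (b + c + n) : ℚ) := by
  rw [rightFactor, of_apply, poch_natCast_succ, ← Nat.cast_add b c, pochDivFactorial_natCast_succ]

theorem pascalMatrix_isLowerTriangular : (pascalMatrix a).IsLowerTriangular := by
  intro i j hij
  have hij : (i : ℕ) < j := hij
  rw [pascalMatrix, of_apply, binom_of_lt (by omega), Int.cast_zero]

theorem leftFactor_isLowerTriangular : (leftFactor a b c).IsLowerTriangular := by
  intro i j hij
  have hij : (i : ℕ) < j := hij
  rw [leftFactor_apply, Nat.choose_eq_zero_of_lt hij, Nat.cast_zero, mul_zero]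

theorem rightFactor_isLowerTriangular : (rightFactor a b c).IsLowerTriangular := by
  intro i j hij
  have hij : (i : ℕ) < j := hij
  rw [rightFactor_apply, Nat.choose_eq_zero_of_lt (by omega), Nat.cast_zero, mul_zero]

variable {a} in
theorem pascalMatrix_mulVec_binom_add (α β : ℤ) (s : Fin a) :
    (pascalMatrix a *ᵥ fun i => (binom α (β + (i : ℕ)) : ℚ)) s = binom (α + s) (β + s) := by
  simpa [pascalMatrix, mulVec, dotProduct] using
    sum_binom_mul_binom_add (R := ℚ) (a := a) (n := s) (x₀ := 0) (by omega) α β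

variable {a} in
theorem pascalMatrix_mulVec_binom_sub (α β : ℤ) (s : Fin a) :
    (pascalMatrix a *ᵥ fun i => (binom α (β - (i : ℕ)) : ℚ)) s = binom (α + s) β := by
  simpa [pascalMatrix, mulVec, dotProduct] using
    sum_binom_mul_binom_sub (R := ℚ) (a := a) (n := s) (x₀ := 0) (by omega) α β

theorem pascalMatrix_mul_pathMatrix_apply (s j : Fin a) :
    (pascalMatrix a * pathMatrix a b c) s j =
      (binom ((b : ℤ) + c + s) ((b : ℤ) + s - j) : ℚ) := by
  rw [add_sub_right_comm (b : ℤ), ← pascalMatrix_mulVec_binom_add, Matrix.mul_apply]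
  simp only [mulVec, dotProduct, pathMatrix, of_apply, add_sub_right_comm]

theorem pascalMatrix_mul_pathMatrix_mul_transpose_apply (s n : Fin a) :
    (pascalMatrix a * pathMatrix a b c * (pascalMatrix a)ᵀ) s n =
      ((b + c + s + n).choose (b + s) : ℚ) := by
  have hchoose := binom_natCast (b + c + s + n) (b + s)
  push_cast at hchoose
  rw [← Int.cast_natCast, ← hchoose, ← pascalMatrix_mulVec_binom_sub,
    Matrix.mul_apply]
  simp only [pascalMatrix_mul_pathMatrix_apply, mulVec, dotProduct,
    transpose_apply, mul_comm]

theorem leftFactor_mul_apply (m n : Fin a) :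
    (leftFactor a b c * (pascalMatrix a * pathMatrix a b c * (pascalMatrix a)ᵀ)) m n =
      (-1 : ℚ) ^ (m : ℕ) * ((b + c).factorial / b.factorial) *
        ((n : ℕ).factorial / (c + n).factorial) *
        ((b + c + n).choose (b + c + m) : ℚ) := by
  have hsum := sum_binom_mul_neg_one_pow_mul_binom (R := ℚ) (a := a) (n := m) (x₀ := 0)
    (by omega) (b + c + n : ℕ) (n : ℕ)
  simp only [Nat.cast_zero, sub_zero, add_zero, ← Nat.cast_add, binom_natCast, binom_add_sub,
    Int.cast_natCast] at hsum
  rw [mul_right_comm _ _ (Nat.cast _), mul_right_comm _ _ (Nat.cast _), ← hsum, sum_mul, sum_mul,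
    mul_apply]
  refine sum_congr rfl fun s _ => ?_
  rw [leftFactor_apply, pascalMatrix_mul_pathMatrix_mul_transpose_apply,
    show b + c + (s : ℕ) + n = (b + s) + (c + n) by omega, Nat.cast_add_choose,
    show b + c + (n : ℕ) + s = n + (b + c + s) by omega, Nat.cast_add_choose,
    show (b + s) + (c + n) = (n : ℕ) + (b + c + s) by omega]
  field_simp

theorem leftFactor_mul_mul_rightFactor_transpose :
    leftFactor a b c * (pascalMatrix a * pathMatrix a b c * (pascalMatrix a)ᵀ) *
        (rightFactor a b c)ᵀ = (((b + c).factorial : ℚ) / (b.factorial * c.factorial)) • 1 := by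
  ext m p
  have hterm (n : Fin a) : (leftFactor a b c * (pascalMatrix a * pathMatrix a b c *
      (pascalMatrix a)ᵀ)) m n * (rightFactor a b c)ᵀ n p =
      ((-1 : ℚ) ^ (m : ℕ) * ((b + c).factorial / (b.factorial * c.factorial))) *
        ((-1 : ℚ) ^ (n : ℕ) *
          ((b + c + p).choose (b + c + n) * (b + c + n).choose (b + c + m))) := by
    rw [leftFactor_mul_apply, transpose_apply, rightFactor_apply]
    field_simp
  rw [mul_apply, Matrix.smul_apply, one_apply, sum_congr rfl fun n _ => hterm n, ← mul_sum,
    sum_neg_one_pow_mul_choose_mul_choose]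
  simp only [Fin.val_inj]
  split_ifs
  · rw [mul_right_comm, ← mul_pow]
    simp
  · simp

theorem det_pascalMatrix : (pascalMatrix a).det = 1 := by
  rw [det_of_isLowerTriangular _ (pascalMatrix_isLowerTriangular a)]
  exact prod_eq_one fun i _ => by simp [pascalMatrix, binom_natCast]

theorem det_leftFactor_mul_det_rightFactor :
    (leftFactor a b c).det * (rightFactor a b c).det = ∏ s : Fin a,
      ((b + c).factorial / (b.factorial * c.factorial) : ℚ) *
        (((b + s).factorial * (c + s).factorial : ℚ) /
          ((b + c + s).factorial * (s : ℕ).factorial)) := by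
  rw [det_of_isLowerTriangular _ (leftFactor_isLowerTriangular a b c),
    det_of_isLowerTriangular _ (rightFactor_isLowerTriangular a b c), ← prod_mul_distrib]
  refine prod_congr rfl fun s _ => ?_
  have hsign : (-1 : ℚ) ^ (s : ℕ) * (-1) ^ (s : ℕ) = 1 := by rw [← mul_pow]; simp
  rw [leftFactor_apply, rightFactor_apply, Nat.choose_self, Nat.choose_self, Nat.cast_one, mul_one,
    mul_one, mul_mul_mul_comm, hsign]
  field_simp

theorem det_pathMatrix :
    (pathMatrix a b c).det = ∏ s : Fin a,
      (((b + c + s).factorial * (s : ℕ).factorial : ℚ) /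
        ((b + s).factorial * (c + s).factorial)) := by
  have hdet := congrArg det (leftFactor_mul_mul_rightFactor_transpose a b c)
  simp only [det_mul, det_transpose, det_pascalMatrix, one_mul, mul_one, det_smul, det_one,
    Fintype.card_fin] at hdet
  rw [mul_right_comm, det_leftFactor_mul_det_rightFactor, ← Fin.prod_const] at hdet
  refine mul_left_cancel₀ (prod_ne_zero_iff.2 fun _ _ => by positivity) (hdet.trans ?_)
  rw [← prod_mul_distrib]
  refine prod_congr rfl fun s _ => ?_
  field_simp

theorem isUnit_det_pathMatrix : IsUnit (pathMatrix a b c).det := by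
  rw [det_pathMatrix]
  exact (prod_ne_zero_iff.2 fun _ _ => by positivity).isUnit

theorem inv_pathMatrix :
    (pathMatrix a b c)⁻¹ = ((b.factorial * c.factorial : ℚ) / (b + c).factorial) •
      ((pascalMatrix a)ᵀ * (rightFactor a b c)ᵀ * (leftFactor a b c * pascalMatrix a)) := by
  have hone : (leftFactor a b c * pascalMatrix a) * (pathMatrix a b c *
      (((b.factorial * c.factorial : ℚ) / (b + c).factorial) •
        ((pascalMatrix a)ᵀ * (rightFactor a b c)ᵀ))) = 1 := by
    have h := leftFactor_mul_mul_rightFactor_transpose a b c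
    simp only [Matrix.mul_assoc, Matrix.mul_smul] at h ⊢
    rw [h, smul_smul]
    convert one_smul ℚ _
    field_simp
  refine inv_eq_right_inv ?_
  rw [← mul_eq_one_comm.1 hone]
  simp only [Matrix.mul_assoc, Matrix.mul_smul, Matrix.smul_mul]

variable {a} in
theorem dotProduct_inv_pathMatrix_mulVec (u v : Fin a → ℚ) :
    v ⬝ᵥ ((pathMatrix a b c)⁻¹ *ᵥ u) =
      ((b.factorial * c.factorial : ℚ) / (b + c).factorial) *
      ((rightFactor a b c *ᵥ (pascalMatrix a *ᵥ v)) ⬝ᵥ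
        (leftFactor a b c *ᵥ (pascalMatrix a *ᵥ u))) := by
  rw [inv_pathMatrix, smul_mulVec, dotProduct_smul, smul_eq_mul, ← mulVec_mulVec, ← mulVec_mulVec,
    ← mulVec_mulVec, dotProduct_mulVec, vecMul_transpose, dotProduct_mulVec, vecMul_transpose]

end PathMatrix

section BoxProduct

@[to_additive]
theorem prod_Icc_eq_prod_fin {M : Type*} [CommMonoid M] (f : ℕ → M) (n : ℕ) :
    ∏ k ∈ Icc 1 n, f k = ∏ k : Fin n, f (k + 1) := by
  rw [← prod_range fun k => f (k + 1), range_eq_Ico, prod_Ico_add' f 0 n 1]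
  rfl

theorem prod_Icc_div_eq_div {z : ℚ} (hz : 1 < z) (c : ℕ) :
    ∏ k ∈ Icc 1 c, (z + k - 1) / (z + k - 2) = (z + c - 1) / (z - 1) := by
  induction c with
  | zero => rw [Icc_eq_empty (by omega), prod_empty, Nat.cast_zero, add_zero,
      div_self (by linarith)]
  | succ c ih =>
    rw [prod_Icc_succ_top (by omega), ih, Nat.cast_succ]
    have hzc : z + c - 1 ≠ 0 := by linarith [c.cast_nonneg (α := ℚ)]
    rw [show z + (c + 1) - 2 = z + c - 1 by ring]
    field_simp

theorem prod_Icc_prod_Icc_div_eq_factorial_div (i b c : ℕ) :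
    ∏ j ∈ Icc 1 b, ∏ k ∈ Icc 1 c,
        (((i + 1 : ℕ) : ℚ) + j + k - 1) / (((i + 1 : ℕ) : ℚ) + j + k - 2) =
      ((b + c + i).factorial * i.factorial : ℚ) / ((b + i).factorial * (c + i).factorial) := by
  induction b with
  | zero =>
    rw [Icc_eq_empty (by omega), prod_empty, zero_add, zero_add, mul_comm,
      div_self (by positivity)]
  | succ b ih =>
    rw [prod_Icc_succ_top (by omega), ih, prod_Icc_div_eq_div (by push_cast; linarith),
      show ((i + 1 : ℕ) : ℚ) + (b + 1 : ℕ) - 1 = i + b + 1 by push_cast; ring,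
      show b + 1 + c + i = (b + c + i) + 1 by ring, show b + 1 + i = (b + i) + 1 by ring,
      Nat.factorial_succ, Nat.factorial_succ]
    push_cast
    field_simp
    ring

theorem prod_box_eq_det_pathMatrix (a b c : ℕ) :
    (∏ i ∈ Icc 1 a, ∏ j ∈ Icc 1 b, ∏ k ∈ Icc 1 c,
      ((i : ℚ) + (j : ℚ) + (k : ℚ) - 1) / ((i : ℚ) + (j : ℚ) + (k : ℚ) - 2)) =
      (pathMatrix a b c).det := by
  rw [prod_Icc_eq_prod_fin, det_pathMatrix]
  exact prod_congr rfl fun i _ => prod_Icc_prod_Icc_div_eq_factorial_div i b c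

end BoxProduct

section Rhombi

variable {a b c : ℕ} {T T' : Finset (Finset UnitTriangle)}

theorem card_vertices (t : UnitTriangle) : t.vertices.card = 3 := by
  obtain ⟨⟨x, y⟩, _ | _⟩ := t <;> simp [UnitTriangle.vertices]

theorem card_vertices_inter_true_iff {x y : ℤ} {u : UnitTriangle} :
    (UnitTriangle.vertices ((x, y), true) ∩ u.vertices).card = 2 ↔
      u = ((x, y), false) ∨ u = ((x - 1, y), false) ∨ u = ((x, y + 1), false) := by
  obtain ⟨⟨x', y'⟩, _ | _⟩ := u <;>
  · rw [← filter_mem_eq_inter, card_filter, UnitTriangle.vertices, UnitTriangle.vertices,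
      sum_insert (by simp), sum_insert (by simp), sum_singleton]
    grind

theorem card_vertices_inter_false_iff {x y : ℤ} {u : UnitTriangle} :
    (UnitTriangle.vertices ((x, y), false) ∩ u.vertices).card = 2 ↔
      u = ((x, y), true) ∨ u = ((x + 1, y), true) ∨ u = ((x, y - 1), true) := by
  obtain ⟨⟨x', y'⟩, _ | _⟩ := u <;>
  · rw [← filter_mem_eq_inter, card_filter, UnitTriangle.vertices, UnitTriangle.vertices,
      sum_insert (by simp), sum_insert (by simp), sum_singleton]
    grind

theorem mem_hexagonTriangles_true {x y : ℤ} :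
    ((x, y), true) ∈ hexagonTriangles a b c ↔
      0 ≤ x ∧ x < a + b ∧ 0 ≤ y ∧ y < a + c ∧ -(b : ℤ) ≤ y - x ∧ y - x < c := by
  rw [hexagonTriangles, mem_filter]
  simp only [UnitTriangle.vertices, mem_product, mem_Icc, mem_univ, InHexagon, mem_insert,
    mem_singleton, forall_eq_or_imp, forall_eq, and_true]
  omega

theorem mem_hexagonTriangles_false {x y : ℤ} :
    ((x, y), false) ∈ hexagonTriangles a b c ↔
      0 ≤ x ∧ x < a + b ∧ 0 ≤ y ∧ y < a + c ∧ -(b : ℤ) < y - x ∧ y - x ≤ c := by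
  rw [hexagonTriangles, mem_filter]
  simp only [UnitTriangle.vertices, mem_product, mem_Icc, mem_univ, InHexagon, mem_insert,
    mem_singleton, forall_eq_or_imp, forall_eq, and_true]
  omega

theorem pair_mem_hexagonRhombi {t u : UnitTriangle} :
    {t, u} ∈ hexagonRhombi a b c ↔ t ∈ hexagonTriangles a b c ∧ u ∈ hexagonTriangles a b c ∧
      (t.vertices ∩ u.vertices).card = 2 := by
  rcases eq_or_ne t u with rfl | htu
  · simp [hexagonRhombi, card_vertices, mem_powersetCard]
  · simp only [hexagonRhombi, mem_filter, mem_powersetCard, card_pair htu, insert_subset_iff,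
      singleton_subset_iff, mem_insert, mem_singleton, forall_eq_or_imp, forall_eq]
    rw [inter_comm u.vertices]
    have := htu.symm
    tauto

theorem exists_eq_pair_of_mem_hexagonRhombi {r : Finset UnitTriangle} {t : UnitTriangle}
    (hr : r ∈ hexagonRhombi a b c) (ht : t ∈ r) : ∃ u, r = {t, u} := by
  have hcard : r.card = 2 := (mem_powersetCard.1 (mem_filter.1 hr).1).2
  obtain ⟨u, hu⟩ := card_eq_one.1 (show (r.erase t).card = 1 by rw [card_erase_of_mem ht, hcard])
  exact ⟨u, by rw [← hu, insert_erase ht]⟩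

theorem pair_right_injective {α : Type*} [DecidableEq α] (t : α) :
    (fun u => ({t, u} : Finset α)).Injective := by
  intro u u' (h : ({t, u} : Finset α) = {t, u'})
  have h₁ : u ∈ ({t, u'} : Finset α) := h ▸ by simp
  have h₂ : u' ∈ ({t, u} : Finset α) := h.symm ▸ by simp
  simp only [mem_insert, mem_singleton] at h₁ h₂
  grind

theorem mem_tilings_iff : T ∈ tilings a b c ↔
    T ⊆ hexagonRhombi a b c ∧ ∀ t ∈ hexagonTriangles a b c, ∃! u, {t, u} ∈ T := by
  rw [tilings, mem_filter, mem_powerset]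
  refine and_congr_right fun hT => forall₂_congr fun t _ => ?_
  rw [card_eq_one_iff_existsUnique]
  constructor
  · rintro ⟨r, hr, hunique⟩
    rw [mem_filter] at hr
    obtain ⟨u, rfl⟩ := exists_eq_pair_of_mem_hexagonRhombi (hT hr.1) hr.2
    exact ⟨u, hr.1, fun u' hu' => pair_right_injective t
      (hunique _ (mem_filter.2 ⟨hu', mem_insert_self t _⟩))⟩
  · rintro ⟨u, hu, hunique⟩
    refine ⟨{t, u}, mem_filter.2 ⟨hu, mem_insert_self t _⟩, fun r hr => ?_⟩
    obtain ⟨hrT, htr⟩ := mem_filter.1 hr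
    obtain ⟨u', rfl⟩ := exists_eq_pair_of_mem_hexagonRhombi (hT hrT) htr
    rw [hunique u' hrT]

theorem eq_of_subset_of_mem_tilings (hT : T ∈ tilings a b c) (hT' : T' ∈ tilings a b c)
    (h : T ⊆ T') : T = T' := by
  rw [mem_tilings_iff] at hT hT'
  refine h.antisymm fun r hr => ?_
  obtain ⟨t, ht⟩ : r.Nonempty := card_pos.1 <| by
    rw [(mem_powersetCard.1 (mem_filter.1 (hT'.1 hr)).1).2]; exact two_pos
  have htH : t ∈ hexagonTriangles a b c :=
    (mem_powersetCard.1 (mem_filter.1 (hT'.1 hr)).1).1 ht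
  obtain ⟨u, rfl⟩ := exists_eq_pair_of_mem_hexagonRhombi (hT'.1 hr) ht
  obtain ⟨u', hu', -⟩ := hT.2 t htH
  rwa [(hT'.2 t htH).unique hr (h hu')]

end Rhombi

section Slices

variable {a b c : ℕ} {t t' u u' : ℕ} {x x' y y' : ℤ}

/-- The unit triangle above the diagonal edge from `(x, x + t - b)` to `(x + 1, x + t - b + 1)`;
the number `t` counts the lines of diagonal edges from the lower right side of the hexagon to the
upper left one. -/
def triangleAbove (b t : ℕ) (x : ℤ) : UnitTriangle := ((x, x + t - b), true)

/-- The unit triangle below the diagonal edge from `(x, x + t - b)` to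
`(x + 1, x + t - b + 1)`. -/
def triangleBelow (b t : ℕ) (x : ℤ) : UnitTriangle := ((x, x + t - b), false)

/-- The rhombus that is cut in two by the diagonal edge from `(x, x + t - b)` to
`(x + 1, x + t - b + 1)`; no path crosses this edge. -/
def gapRhombus (b t : ℕ) (x : ℤ) : Finset UnitTriangle := {triangleAbove b t x, triangleBelow b t x}

/-- The rhombus through which a path moves from position `x` at time `t` to position `x'` at
time `t + 1`. -/
def stepRhombus (b t : ℕ) (x x' : ℤ) : Finset UnitTriangle :=
  {triangleAbove b t x, triangleBelow b (t + 1) x'}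

/-- The diagonal edge from `(x, x + t - b)` to `(x + 1, x + t - b + 1)` lies between the two
vertical sides and between the two sides of length `b` of the hexagon. -/
def InSlice (a b c t : ℕ) (x : ℤ) : Prop :=
  0 ≤ x ∧ x < a + b ∧ 0 ≤ x + t - b ∧ x + t - b < a + c

theorem inSlice_zero_iff : InSlice a b c 0 x ↔ ∃ j : Fin a, (b + j : ℤ) = x := by
  rw [InSlice]
  refine ⟨fun h => ⟨⟨(x - b).toNat, by omega⟩, by simp only; omega⟩, ?_⟩
  rintro ⟨j, rfl⟩
  omega

theorem inSlice_add_iff : InSlice a b c (b + c) x ↔ ∃ j : Fin a, (j : ℤ) = x := by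
  rw [InSlice]
  refine ⟨fun h => ⟨⟨x.toNat, by omega⟩, by simp only; omega⟩, ?_⟩
  rintro ⟨j, rfl⟩
  omega

theorem triangleAbove_mem_hexagonTriangles :
    triangleAbove b t x ∈ hexagonTriangles a b c ↔ t < b + c ∧ InSlice a b c t x := by
  rw [triangleAbove, mem_hexagonTriangles_true, InSlice]
  omega

theorem triangleBelow_mem_hexagonTriangles :
    triangleBelow b t x ∈ hexagonTriangles a b c ↔ (0 < t ∧ t ≤ b + c) ∧ InSlice a b c t x := by
  rw [triangleBelow, mem_hexagonTriangles_false, InSlice]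
  omega

theorem exists_eq_triangle_of_mem_hexagonTriangles {p : UnitTriangle}
    (hp : p ∈ hexagonTriangles a b c) :
    ∃ t x, p = triangleAbove b t x ∨ p = triangleBelow b (t + 1) x := by
  obtain ⟨⟨x, y⟩, _ | _⟩ := p
  · rw [mem_hexagonTriangles_false] at hp
    refine ⟨(y - x + b - 1).toNat, x, Or.inr ?_⟩
    simp only [triangleBelow, Prod.mk.injEq, true_and, and_true]
    omega
  · rw [mem_hexagonTriangles_true] at hp
    refine ⟨(y - x + b).toNat, x, Or.inl ?_⟩
    simp only [triangleAbove, Prod.mk.injEq, true_and, and_true]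
    omega

theorem pair_triangleAbove_mem_hexagonRhombi {p : UnitTriangle} :
    {triangleAbove b t x, p} ∈ hexagonRhombi a b c ↔
      triangleAbove b t x ∈ hexagonTriangles a b c ∧ p ∈ hexagonTriangles a b c ∧
        (p = triangleBelow b t x ∨ ∃ x' ∈ unitSteps t x, p = triangleBelow b (t + 1) x') := by
  have h₁ : x + t - b = x - 1 + (t + 1 : ℕ) - b := by push_cast; ring
  have h₂ : x + t - b + 1 = x + (t + 1 : ℕ) - b := by push_cast; ring
  rw [pair_mem_hexagonRhombi, triangleAbove, card_vertices_inter_true_iff]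
  simp only [mem_unitSteps, exists_eq_or_imp, exists_eq_left, triangleBelow, ← h₁, ← h₂,
    or_comm (a := p = ((x - 1, x + t - b), false))]

theorem pair_triangleBelow_mem_hexagonRhombi {p : UnitTriangle} :
    {triangleBelow b (t + 1) x', p} ∈ hexagonRhombi a b c ↔
      triangleBelow b (t + 1) x' ∈ hexagonTriangles a b c ∧ p ∈ hexagonTriangles a b c ∧
        (p = triangleAbove b (t + 1) x' ∨
          ∃ x, x' ∈ unitSteps t x ∧ p = triangleAbove b t x) := by
  have h₁ : x' + (t + 1 : ℕ) - b = x' + 1 + t - b := by push_cast; ring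
  have h₂ : x' + (t + 1 : ℕ) - b - 1 = x' + t - b := by push_cast; ring
  rw [pair_mem_hexagonRhombi, triangleBelow, card_vertices_inter_false_iff]
  simp only [mem_unitSteps, eq_sub_iff_add_eq, or_and_right, exists_or, exists_eq_left',
    triangleAbove, ← h₁, ← h₂, or_comm (a := p = ((x' + 1, x' + (t + 1 : ℕ) - b), true))]

theorem pair_triangleAbove_triangleBelow_inj :
    ({triangleAbove b t x, triangleBelow b t' x'} : Finset UnitTriangle) =
        {triangleAbove b u y, triangleBelow b u' y'} ↔
      (t = u ∧ x = y) ∧ t' = u' ∧ x' = y' := by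
  refine ⟨fun h => ?_, ?_⟩
  · have habove : triangleAbove b t x ∈ {triangleAbove b u y, triangleBelow b u' y'} :=
      h ▸ mem_insert_self _ _
    have hbelow : triangleBelow b t' x' ∈ {triangleAbove b u y, triangleBelow b u' y'} :=
      h ▸ mem_insert_of_mem (mem_singleton_self _)
    simp only [triangleAbove, triangleBelow, mem_insert, mem_singleton, Prod.mk.injEq,
      Bool.true_eq_false, Bool.false_eq_true, and_true, and_false, or_false, false_or]
      at habove hbelow
    omega
  · rintro ⟨⟨rfl, rfl⟩, rfl, rfl⟩
    rfl

theorem gapRhombus_mem_hexagonRhombi :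
    gapRhombus b t x ∈ hexagonRhombi a b c ↔ (0 < t ∧ t < b + c) ∧ InSlice a b c t x := by
  rw [gapRhombus, pair_triangleAbove_mem_hexagonRhombi, triangleAbove_mem_hexagonTriangles,
    triangleBelow_mem_hexagonTriangles]
  simp only [true_or, and_true]
  have : t < b + c → t ≤ b + c := le_of_lt
  tauto

theorem stepRhombus_mem_hexagonRhombi :
    stepRhombus b t x x' ∈ hexagonRhombi a b c ↔ t < b + c ∧ x' ∈ unitSteps t x ∧
      InSlice a b c t x ∧ InSlice a b c (t + 1) x' := by
  have hadjacent : (triangleBelow b (t + 1) x' = triangleBelow b t x ∨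
      ∃ x'' ∈ unitSteps t x, triangleBelow b (t + 1) x' = triangleBelow b (t + 1) x'') ↔
        x' ∈ unitSteps t x := by
    simp only [triangleBelow, mem_unitSteps, exists_eq_or_imp, exists_eq_left, Prod.mk.injEq,
      and_true]
    omega
  rw [stepRhombus, pair_triangleAbove_mem_hexagonRhombi, triangleAbove_mem_hexagonTriangles,
    triangleBelow_mem_hexagonTriangles, hadjacent, Nat.succ_le_iff]
  have := t.succ_pos
  tauto

theorem horizontalRhombus_eq_stepRhombus (h : -(b : ℤ) ≤ y - x) :
    horizontalRhombus x y = stepRhombus b (y - x + b).toNat x (x - 1) := by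
  rw [horizontalRhombus, stepRhombus, pair_comm, triangleAbove, triangleBelow]
  congr 3 <;> grind

end Slices

section TilingOfPaths

open scoped Classical in
/-- The rhombus tiling whose paths are given by the family `s`: the diagonal edges that lie on no
path are covered by gap rhombi. -/
noncomputable def tilingOf {a : ℕ} (b c : ℕ) (s : ℕ → Fin a → ℤ) : Finset (Finset UnitTriangle) :=
  (hexagonRhombi a b c).filter fun r =>
    (∃ t x, r = gapRhombus b t x ∧ ∀ j, s t j ≠ x) ∨
      ∃ t j, r = stepRhombus b t (s t j) (s (t + 1) j)

variable {a b c t : ℕ} {x x' : ℤ} {s : ℕ → Fin a → ℤ} {r : Finset UnitTriangle}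

theorem mem_tilingOf :
    r ∈ tilingOf b c s ↔ r ∈ hexagonRhombi a b c ∧
      ((∃ t x, r = gapRhombus b t x ∧ ∀ j, s t j ≠ x) ∨
        ∃ t j, r = stepRhombus b t (s t j) (s (t + 1) j)) := by
  classical exact mem_filter

theorem tilingOf_subset_hexagonRhombi : tilingOf b c s ⊆ hexagonRhombi a b c :=
  fun _ hr => (mem_tilingOf.1 hr).1

theorem gapRhombus_mem_tilingOf_iff :
    gapRhombus b t x ∈ tilingOf b c s ↔
      gapRhombus b t x ∈ hexagonRhombi a b c ∧ ∀ j, s t j ≠ x := by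
  rw [mem_tilingOf]
  refine and_congr_right fun _ => ⟨?_, fun h => Or.inl ⟨t, x, rfl, h⟩⟩
  rintro (⟨u, y, h, hy⟩ | ⟨u, j, h⟩) <;>
    obtain ⟨⟨rfl, rfl⟩, hu, _⟩ := pair_triangleAbove_triangleBelow_inj.1 h
  · exact hy
  · omega

theorem stepRhombus_mem_tilingOf_iff :
    stepRhombus b t x x' ∈ tilingOf b c s ↔
      stepRhombus b t x x' ∈ hexagonRhombi a b c ∧ ∃ j, s t j = x ∧ s (t + 1) j = x' := by
  rw [mem_tilingOf]
  refine and_congr_right fun _ => ⟨?_, ?_⟩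
  · rintro (⟨u, y, h, hy⟩ | ⟨u, j, h⟩) <;>
      obtain ⟨⟨rfl, rfl⟩, hu, hx⟩ := pair_triangleAbove_triangleBelow_inj.1 h
    · omega
    · exact ⟨j, rfl, hx.symm⟩
  · rintro ⟨j, rfl, rfl⟩
    exact Or.inr ⟨t, j, rfl⟩

theorem strictMono_coe_fin (a : ℕ) : StrictMono fun j : Fin a => (j : ℤ) :=
  Nat.strictMono_cast.comp Fin.val_strictMono

/-- The families of paths that correspond to the rhombus tilings of the hexagon. -/
abbrev IsHexagonPathFamily (a b c : ℕ) : (ℕ → Fin a → ℤ) → Prop :=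
  IsPathFamily unitSteps (b + c) (fun j => (b + j : ℤ)) fun j => (j : ℤ)

namespace IsHexagonPathFamily

theorem succ_mem_unitSteps (hs : IsHexagonPathFamily a b c s) (t : ℕ) (j : Fin a) :
    s (t + 1) j ∈ unitSteps t (s t j) := by
  rcases lt_or_ge t (b + c) with ht | ht
  · exact hs.step t ht j
  · rw [hs.eq_end t ht, hs.eq_end (t + 1) (ht.trans t.le_succ), mem_unitSteps]
    exact Or.inl rfl

theorem apply_add_mem_Icc (hs : IsHexagonPathFamily a b c s) (t d : ℕ) (j : Fin a) :
    s (t + d) j ∈ Icc (s t j - d) (s t j) := by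
  induction d with
  | zero => simp
  | succ d ih =>
    have := hs.succ_mem_unitSteps (t + d) j
    rw [mem_unitSteps] at this
    rw [mem_Icc] at ih ⊢
    rw [← add_assoc]
    omega

theorem inSlice (hs : IsHexagonPathFamily a b c s) (ht : t ≤ b + c) (j : Fin a) :
    InSlice a b c t (s t j) := by
  obtain ⟨d, hd⟩ := Nat.exists_eq_add_of_le ht
  have hstart := hs.apply_add_mem_Icc 0 t j
  have hend := hs.apply_add_mem_Icc t d j
  rw [hs.start, zero_add, mem_Icc] at hstart
  rw [hs.eq_end (t + d) hd.le, mem_Icc] at hend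
  beta_reduce at hstart hend
  rw [InSlice]
  omega

theorem stepRhombus_mem_tilingOf (hs : IsHexagonPathFamily a b c s) (ht : t < b + c) (j : Fin a) :
    stepRhombus b t (s t j) (s (t + 1) j) ∈ tilingOf b c s :=
  stepRhombus_mem_tilingOf_iff.2 ⟨stepRhombus_mem_hexagonRhombi.2
    ⟨ht, hs.succ_mem_unitSteps t j, hs.inSlice ht.le j, hs.inSlice ht j⟩, j, rfl, rfl⟩

theorem existsUnique_triangleAbove (hs : IsHexagonPathFamily a b c s)
    (hx : triangleAbove b t x ∈ hexagonTriangles a b c) :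
    ∃! p, {triangleAbove b t x, p} ∈ tilingOf b c s := by
  obtain ⟨ht, hx⟩ := triangleAbove_mem_hexagonTriangles.1 hx
  by_cases h : ∃ j, s t j = x
  · obtain ⟨j, rfl⟩ := h
    refine ⟨_, hs.stepRhombus_mem_tilingOf ht j, fun p hp => ?_⟩
    obtain ⟨-, -, rfl | ⟨x', -, rfl⟩⟩ :=
      pair_triangleAbove_mem_hexagonRhombi.1 (tilingOf_subset_hexagonRhombi hp)
    · exact absurd rfl ((gapRhombus_mem_tilingOf_iff.1 hp).2 j)
    · obtain ⟨-, i, hi, rfl⟩ := stepRhombus_mem_tilingOf_iff.1 hp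
      rw [(hs.strictMono t).injective hi]
  · have ht₀ : 0 < t := Nat.pos_of_ne_zero fun ht₀ => h <| by
      subst ht₀
      obtain ⟨j, rfl⟩ := inSlice_zero_iff.1 hx
      exact ⟨j, by rw [hs.start]⟩
    refine ⟨_, gapRhombus_mem_tilingOf_iff.2 ⟨gapRhombus_mem_hexagonRhombi.2 ⟨⟨ht₀, ht⟩, hx⟩,
      not_exists.1 h⟩, fun p hp => ?_⟩
    obtain ⟨-, -, rfl | ⟨x', -, rfl⟩⟩ :=
      pair_triangleAbove_mem_hexagonRhombi.1 (tilingOf_subset_hexagonRhombi hp)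
    · rfl
    · obtain ⟨-, j, hj, -⟩ := stepRhombus_mem_tilingOf_iff.1 hp
      exact absurd ⟨j, hj⟩ h

theorem existsUnique_triangleBelow (hs : IsHexagonPathFamily a b c s)
    (hx' : triangleBelow b (t + 1) x' ∈ hexagonTriangles a b c) :
    ∃! p, {triangleBelow b (t + 1) x', p} ∈ tilingOf b c s := by
  obtain ⟨⟨-, ht⟩, hx'⟩ := triangleBelow_mem_hexagonTriangles.1 hx'
  by_cases h : ∃ j, s (t + 1) j = x'
  · obtain ⟨j, rfl⟩ := h
    refine ⟨triangleAbove b t (s t j), ?_, fun p hp => ?_⟩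
    · beta_reduce
      rw [pair_comm]
      exact hs.stepRhombus_mem_tilingOf ht j
    obtain ⟨-, -, rfl | ⟨x, -, rfl⟩⟩ :=
      pair_triangleBelow_mem_hexagonRhombi.1 (tilingOf_subset_hexagonRhombi hp)
    · rw [pair_comm] at hp
      exact absurd rfl ((gapRhombus_mem_tilingOf_iff.1 hp).2 j)
    · rw [pair_comm] at hp
      obtain ⟨-, i, rfl, hi⟩ := stepRhombus_mem_tilingOf_iff.1 hp
      rw [(hs.strictMono (t + 1)).injective hi]
  · have ht' : t + 1 < b + c := lt_of_le_of_ne ht fun ht' => h <| by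
      rw [ht'] at hx' ⊢
      obtain ⟨j, rfl⟩ := inSlice_add_iff.1 hx'
      exact ⟨j, by rw [hs.eq_end _ le_rfl]⟩
    refine ⟨triangleAbove b (t + 1) x', ?_, fun p hp => ?_⟩
    · beta_reduce
      rw [pair_comm]
      exact gapRhombus_mem_tilingOf_iff.2 ⟨gapRhombus_mem_hexagonRhombi.2
        ⟨⟨t.succ_pos, ht'⟩, hx'⟩, not_exists.1 h⟩
    obtain ⟨-, -, rfl | ⟨x, -, rfl⟩⟩ :=
      pair_triangleBelow_mem_hexagonRhombi.1 (tilingOf_subset_hexagonRhombi hp)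
    · rfl
    · rw [pair_comm] at hp
      obtain ⟨-, j, -, hj⟩ := stepRhombus_mem_tilingOf_iff.1 hp
      exact absurd ⟨j, hj⟩ h

theorem tilingOf_mem_tilings (hs : IsHexagonPathFamily a b c s) :
    tilingOf b c s ∈ tilings a b c := by
  refine mem_tilings_iff.2 ⟨tilingOf_subset_hexagonRhombi, fun p hp => ?_⟩
  obtain ⟨t, x, rfl | rfl⟩ := exists_eq_triangle_of_mem_hexagonTriangles hp
  · exact hs.existsUnique_triangleAbove hp
  · exact hs.existsUnique_triangleBelow hp

end IsHexagonPathFamily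

end TilingOfPaths

section PathsOfTiling

/-- The position at time `t + 1` of the path of the tiling `T` that is at position `x` at
time `t`. -/
def nextPosition (b : ℕ) (T : Finset (Finset UnitTriangle)) (t : ℕ) (x : ℤ) : ℤ :=
  if stepRhombus b t x (x - 1) ∈ T then x - 1 else x

/-- The family of paths of the rhombus tiling `T`. -/
def pathsOf (a b : ℕ) (T : Finset (Finset UnitTriangle)) : ℕ → Fin a → ℤ
  | 0, j => b + j
  | t + 1, j => nextPosition b T t (pathsOf a b T t j)

/-- A path of the tiling `T` crosses the diagonal edge from `(x, x + t - b)` to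
`(x + 1, x + t - b + 1)`, or starts or ends there. -/
def IsCrossed (a b c : ℕ) (T : Finset (Finset UnitTriangle)) (t : ℕ) (x : ℤ) : Prop :=
  InSlice a b c t x ∧ gapRhombus b t x ∉ T

variable {a b c t : ℕ} {x x' y : ℤ} {T : Finset (Finset UnitTriangle)}

theorem nextPosition_mem_unitSteps : nextPosition b T t x ∈ unitSteps t x := by
  rw [nextPosition, mem_unitSteps]
  split_ifs <;> simp

theorem nextPosition_of_le (hT : T ∈ tilings a b c) (ht : b + c ≤ t) :
    nextPosition b T t x = x :=
  if_neg fun h => ht.not_gt (stepRhombus_mem_hexagonRhombi.1 ((mem_tilings_iff.1 hT).1 h)).1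

theorem triangleAbove_partner_unique (hT : T ∈ tilings a b c) {p q : UnitTriangle}
    (hp : {triangleAbove b t x, p} ∈ T) (hq : {triangleAbove b t x, q} ∈ T) : p = q :=
  ((mem_tilings_iff.1 hT).2 _
    (pair_mem_hexagonRhombi.1 ((mem_tilings_iff.1 hT).1 hp)).1).unique hp hq

theorem triangleBelow_partner_unique (hT : T ∈ tilings a b c) {p q : UnitTriangle}
    (hp : {p, triangleBelow b t x} ∈ T) (hq : {q, triangleBelow b t x} ∈ T) : p = q := by
  have hx := (pair_mem_hexagonRhombi.1 ((mem_tilings_iff.1 hT).1 hp)).2.1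
  rw [pair_comm] at hp hq
  exact ((mem_tilings_iff.1 hT).2 _ hx).unique hp hq

theorem nextPosition_eq_of_stepRhombus_mem (hT : T ∈ tilings a b c)
    (h : stepRhombus b t x x' ∈ T) : nextPosition b T t x = x' := by
  have hx' := (stepRhombus_mem_hexagonRhombi.1 ((mem_tilings_iff.1 hT).1 h)).2.1
  rw [nextPosition]
  split_ifs with hdown
  · have := triangleAbove_partner_unique hT hdown h
    simp only [triangleBelow, Prod.mk.injEq, and_true] at this
    exact this.1
  · rcases mem_unitSteps.1 hx' with rfl | rfl
    · rfl
    · exact absurd h hdown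

theorem isCrossed_left_of_stepRhombus_mem (hT : T ∈ tilings a b c)
    (h : stepRhombus b t x x' ∈ T) : IsCrossed a b c T t x := by
  refine ⟨(stepRhombus_mem_hexagonRhombi.1 ((mem_tilings_iff.1 hT).1 h)).2.2.1, fun hgap => ?_⟩
  have := triangleAbove_partner_unique hT h hgap
  simp only [triangleBelow, Prod.mk.injEq, and_true] at this
  omega

theorem isCrossed_right_of_stepRhombus_mem (hT : T ∈ tilings a b c)
    (h : stepRhombus b t x x' ∈ T) : IsCrossed a b c T (t + 1) x' := by
  refine ⟨(stepRhombus_mem_hexagonRhombi.1 ((mem_tilings_iff.1 hT).1 h)).2.2.2, fun hgap => ?_⟩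
  have := triangleBelow_partner_unique hT h hgap
  simp only [triangleAbove, Prod.mk.injEq, and_true] at this
  omega

theorem IsCrossed.stepRhombus_nextPosition_mem (hT : T ∈ tilings a b c)
    (hx : IsCrossed a b c T t x) (ht : t < b + c) :
    stepRhombus b t x (nextPosition b T t x) ∈ T := by
  obtain ⟨p, hp, -⟩ := (mem_tilings_iff.1 hT).2 _ (triangleAbove_mem_hexagonTriangles.2 ⟨ht, hx.1⟩)
  obtain ⟨-, -, rfl | ⟨x', -, rfl⟩⟩ :=
    pair_triangleAbove_mem_hexagonRhombi.1 ((mem_tilings_iff.1 hT).1 hp)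
  · exact absurd hp hx.2
  · rwa [nextPosition_eq_of_stepRhombus_mem hT hp]

theorem IsCrossed.exists_stepRhombus_mem (hT : T ∈ tilings a b c)
    (hx' : IsCrossed a b c T (t + 1) x') (ht : t < b + c) : ∃ x, stepRhombus b t x x' ∈ T := by
  obtain ⟨p, hp, -⟩ := (mem_tilings_iff.1 hT).2 _
    (triangleBelow_mem_hexagonTriangles.2 ⟨⟨t.succ_pos, ht⟩, hx'.1⟩)
  obtain ⟨-, -, rfl | ⟨x, -, rfl⟩⟩ :=
    pair_triangleBelow_mem_hexagonRhombi.1 ((mem_tilings_iff.1 hT).1 hp) <;> rw [pair_comm] at hp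
  · exact absurd hp hx'.2
  · exact ⟨x, hp⟩

theorem isCrossed_succ_iff (hT : T ∈ tilings a b c) (ht : t < b + c) :
    IsCrossed a b c T (t + 1) x' ↔ ∃ x, IsCrossed a b c T t x ∧ nextPosition b T t x = x' := by
  constructor
  · intro hx'
    obtain ⟨x, hx⟩ := hx'.exists_stepRhombus_mem hT ht
    exact ⟨x, isCrossed_left_of_stepRhombus_mem hT hx, nextPosition_eq_of_stepRhombus_mem hT hx⟩
  · rintro ⟨x, hx, rfl⟩
    exact isCrossed_right_of_stepRhombus_mem hT (hx.stepRhombus_nextPosition_mem hT ht)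

theorem IsCrossed.nextPosition_lt_nextPosition (hT : T ∈ tilings a b c)
    (hx : IsCrossed a b c T t x) (hy : IsCrossed a b c T t y) (ht : t < b + c) (hxy : x < y) :
    nextPosition b T t x < nextPosition b T t y := by
  refine lt_of_le_of_ne (le_of_mem_unitSteps t x y hxy _ nextPosition_mem_unitSteps _
    nextPosition_mem_unitSteps) fun h => hxy.ne ?_
  have hx_step := hx.stepRhombus_nextPosition_mem hT ht
  rw [h] at hx_step
  have := triangleBelow_partner_unique hT hx_step (hy.stepRhombus_nextPosition_mem hT ht)
  simp only [triangleAbove, Prod.mk.injEq, and_true] at this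
  exact this.1

theorem isCrossed_iff_exists_pathsOf_eq (hT : T ∈ tilings a b c) (ht : t ≤ b + c) :
    IsCrossed a b c T t x ↔ ∃ j, pathsOf a b T t j = x := by
  induction t generalizing x with
  | zero =>
    have hgap : gapRhombus b 0 x ∉ T := fun h =>
      (gapRhombus_mem_hexagonRhombi.1 ((mem_tilings_iff.1 hT).1 h)).1.1.ne rfl
    simp only [IsCrossed, hgap, inSlice_zero_iff, pathsOf, not_false_eq_true, and_true]
  | succ t ih =>
    simp only [isCrossed_succ_iff hT ht, ih (Nat.le_of_succ_le ht), pathsOf,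
      exists_exists_eq_and]

theorem strictMono_pathsOf_of_le (hT : T ∈ tilings a b c) (ht : t ≤ b + c) :
    StrictMono (pathsOf a b T t) := by
  induction t with
  | zero => exact (strictMono_coe_fin a).const_add (b : ℤ)
  | succ t ih =>
    have hcrossed (j) := (isCrossed_iff_exists_pathsOf_eq hT (Nat.le_of_succ_le ht)).2 ⟨j, rfl⟩
    exact fun i j hij => (hcrossed i).nextPosition_lt_nextPosition hT (hcrossed j) ht
      (ih (Nat.le_of_succ_le ht) hij)

theorem pathsOf_eq_end (hT : T ∈ tilings a b c) (ht : b + c ≤ t) :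
    pathsOf a b T t = fun j : Fin a => (j : ℤ) := by
  induction t, ht using Nat.le_induction with
  | base =>
    refine ((strictMono_pathsOf_of_le hT le_rfl).range_inj (strictMono_coe_fin a)).1 <|
      Set.ext fun x => ?_
    have hgap : gapRhombus b (b + c) x ∉ T := fun h =>
      (gapRhombus_mem_hexagonRhombi.1 ((mem_tilings_iff.1 hT).1 h)).1.2.ne rfl
    rw [Set.mem_range, Set.mem_range, ← isCrossed_iff_exists_pathsOf_eq hT le_rfl, IsCrossed,
      inSlice_add_iff, and_iff_left hgap]
  | succ t ht ih =>
    funext j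
    rw [pathsOf, nextPosition_of_le hT ht, ih]

theorem isHexagonPathFamily_pathsOf (hT : T ∈ tilings a b c) :
    IsHexagonPathFamily a b c (pathsOf a b T) where
  start := rfl
  eq_end _ := pathsOf_eq_end hT
  step _ _ _ := nextPosition_mem_unitSteps
  strictMono t := by
    rcases le_total t (b + c) with ht | ht
    · exact strictMono_pathsOf_of_le hT ht
    · rw [pathsOf_eq_end hT ht, ← pathsOf_eq_end hT le_rfl]
      exact strictMono_pathsOf_of_le hT le_rfl

theorem tilingOf_pathsOf (hT : T ∈ tilings a b c) : tilingOf b c (pathsOf a b T) = T := by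
  refine eq_of_subset_of_mem_tilings (isHexagonPathFamily_pathsOf hT).tilingOf_mem_tilings hT
    fun r hr => ?_
  obtain ⟨hr, ⟨t, x, rfl, hx⟩ | ⟨t, j, rfl⟩⟩ := mem_tilingOf.1 hr
  · obtain ⟨⟨-, ht⟩, hslice⟩ := gapRhombus_mem_hexagonRhombi.1 hr
    by_contra hgap
    obtain ⟨j, hj⟩ := (isCrossed_iff_exists_pathsOf_eq hT ht.le).1 ⟨hslice, hgap⟩
    exact hx j hj
  · have ht := (stepRhombus_mem_hexagonRhombi.1 hr).1
    exact ((isCrossed_iff_exists_pathsOf_eq hT ht.le).2 ⟨j, rfl⟩).stepRhombus_nextPosition_mem hT ht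

theorem IsHexagonPathFamily.pathsOf_tilingOf {s : ℕ → Fin a → ℤ}
    (hs : IsHexagonPathFamily a b c s) : pathsOf a b (tilingOf b c s) = s := by
  funext t j
  induction t with
  | zero => rw [hs.start, pathsOf]
  | succ t ih =>
    rw [pathsOf, ih]
    rcases lt_or_ge t (b + c) with ht | ht
    · exact nextPosition_eq_of_stepRhombus_mem hs.tilingOf_mem_tilings
        (hs.stepRhombus_mem_tilingOf ht j)
    · rw [nextPosition_of_le hs.tilingOf_mem_tilings ht, hs.eq_end t ht,
        hs.eq_end (t + 1) (ht.trans t.le_succ)]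

/-- The correspondence between rhombus tilings and families of non-intersecting lattice paths. -/
noncomputable def tilingsEquiv (a b c : ℕ) :
    tilings a b c ≃ {s // IsHexagonPathFamily a b c s} where
  toFun T := ⟨pathsOf a b T.1, isHexagonPathFamily_pathsOf T.2⟩
  invFun s := ⟨tilingOf b c s.1, s.2.tilingOf_mem_tilings⟩
  left_inv T := Subtype.ext (tilingOf_pathsOf T.2)
  right_inv s := Subtype.ext s.2.pathsOf_tilingOf

end PathsOfTiling

section Counting

variable {a b c t₀ : ℕ} {x y : ℤ} {s : ℕ → Fin a → ℤ}

theorem card_filter_tilings (P : Finset (Finset UnitTriangle) → Prop) [DecidablePred P] :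
    ((tilings a b c).filter P).card =
      Nat.card {s // IsHexagonPathFamily a b c s ∧ P (tilingOf b c s)} := by
  rw [← Fintype.card_coe, ← Nat.card_eq_fintype_card]
  refine Nat.card_congr <| (Equiv.subtypeEquivProp (by ext; rw [mem_filter])).trans <|
    (Equiv.subtypeSubtypeEquivSubtypeInter (· ∈ tilings a b c) P).symm.trans <|
    ((tilingsEquiv a b c).subtypeEquiv fun T => ?_).trans <|
    Equiv.subtypeSubtypeEquivSubtypeInter _ fun s => P (tilingOf b c s)
  rw [show tilingOf b c (tilingsEquiv a b c T).1 = T from tilingOf_pathsOf T.2]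

theorem isPathFamily_unitStepsAvoiding_iff (ht₀ : t₀ < b + c) :
    IsPathFamily (unitStepsAvoiding t₀ x) (b + c) (fun j : Fin a => (b + j : ℤ)) (fun j => (j : ℤ))
        s ↔
      IsHexagonPathFamily a b c s ∧ stepRhombus b t₀ x (x - 1) ∉ tilingOf b c s := by
  refine ⟨fun hs => ⟨⟨hs.start, hs.eq_end, fun t ht j => (mem_unitStepsAvoiding.1
    (hs.step t ht j)).1, hs.strictMono⟩, fun hx => ?_⟩, fun ⟨hs, hx⟩ => ⟨hs.start, hs.eq_end,
    fun t ht j => mem_unitStepsAvoiding.2 ⟨hs.step t ht j, ?_⟩, hs.strictMono⟩⟩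
  · obtain ⟨-, j, hj, hj'⟩ := stepRhombus_mem_tilingOf_iff.1 hx
    exact (mem_unitStepsAvoiding.1 (hs.step t₀ ht₀ j)).2 ⟨rfl, hj, hj'⟩
  · rintro ⟨rfl, hj, hj'⟩
    have hstep := hs.stepRhombus_mem_tilingOf ht j
    rw [hj, hj'] at hstep
    exact hx hstep

/-- The numbers of lattice paths from the starting points to the right edge of the horizontal
rhombus with lowest vertex `(x, y)`. -/
noncomputable def startVector (a b : ℕ) (x y : ℤ) : Fin a → ℚ :=
  fun i => (binom ((b : ℤ) + y - x) ((b : ℤ) - x + (i : ℕ)) : ℚ)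

/-- The numbers of lattice paths from the left edge of the horizontal rhombus with lowest vertex
`(x, y)` to the end points. -/
noncomputable def endVector (a c : ℕ) (x y : ℤ) : Fin a → ℚ :=
  fun j => (binom ((c : ℤ) + x - y - 1) (x - 1 - (j : ℕ)) : ℚ)

theorem pathCountMatrix_unitSteps :
    pathCountMatrix ℚ unitSteps (b + c) (fun i : Fin a => (b + i : ℤ)) (fun j : Fin a => (j : ℤ)) =
      pathMatrix a b c := by
  ext i j
  rw [pathCountMatrix, of_apply, ← Int.cast_natCast, pathCount_unitSteps, Nat.cast_add, pathMatrix,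
    of_apply]

theorem pathCountMatrix_unitStepsAvoiding (hxy : -(b : ℤ) ≤ y - x) (hyx : y - x < c) :
    pathCountMatrix ℚ (unitStepsAvoiding (y - x + b).toNat x) (b + c)
        (fun i : Fin a => (b + i : ℤ)) (fun j : Fin a => (j : ℤ)) =
      pathMatrix a b c - vecMulVec (startVector a b x y) (endVector a c x y) := by
  obtain ⟨t₀, ht₀⟩ : ∃ t₀ : ℕ, (t₀ : ℤ) = y - x + b := ⟨(y - x + b).toNat, by omega⟩
  obtain ⟨m, hm⟩ := Nat.exists_eq_add_of_le (show t₀ + 1 ≤ b + c by omega)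
  ext i j
  rw [pathCountMatrix, of_apply, ← ht₀, Int.toNat_natCast, hm, ← Int.cast_natCast,
    pathCount_unitStepsAvoiding, ← hm, Matrix.sub_apply, pathMatrix, of_apply, vecMulVec_apply,
    startVector, endVector, ht₀, show (m : ℤ) = c + x - y - 1 by omega]
  push_cast
  ring_nf

theorem card_tilings : ((tilings a b c).card : ℚ) = (pathMatrix a b c).det := by
  rw [← Fintype.card_coe, ← Nat.card_eq_fintype_card, Nat.card_congr (tilingsEquiv a b c),
    natCard_isPathFamily_eq_det ℚ le_of_mem_unitSteps ((strictMono_coe_fin a).const_add _)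
      (strictMono_coe_fin a),
    pathCountMatrix_unitSteps]

theorem card_tilings_not_mem (hxy : -(b : ℤ) ≤ y - x) (hyx : y - x < c) :
    (((tilings a b c).filter fun T => horizontalRhombus x y ∉ T).card : ℚ) =
      (pathMatrix a b c - vecMulVec (startVector a b x y) (endVector a c x y)).det := by
  have hstep (t : ℕ) (x' y' : ℤ) (hxy' : x' < y') (x'' : ℤ)
      (hx : x'' ∈ unitStepsAvoiding (y - x + b).toNat x t x') (y'' : ℤ)
      (hy : y'' ∈ unitStepsAvoiding (y - x + b).toNat x t y') : x'' ≤ y'' :=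
    le_of_mem_unitSteps t x' y' hxy' x'' (mem_unitStepsAvoiding.1 hx).1 y''
      (mem_unitStepsAvoiding.1 hy).1
  rw [card_filter_tilings, horizontalRhombus_eq_stepRhombus hxy]
  simp only [← isPathFamily_unitStepsAvoiding_iff (show (y - x + b).toNat < b + c by omega)]
  rw [natCard_isPathFamily_eq_det ℚ hstep ((strictMono_coe_fin a).const_add _)
    (strictMono_coe_fin a), pathCountMatrix_unitStepsAvoiding hxy hyx]

theorem det_sub_vecMulVec {R ι : Type*} [CommRing R] [Fintype ι] [DecidableEq ι]
    {M : Matrix ι ι R} (hM : IsUnit M.det) (u v : ι → R) :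
    (M - vecMulVec u v).det = M.det * (1 - v ⬝ᵥ (M⁻¹ *ᵥ u)) := by
  rw [sub_eq_add_neg, ← neg_vecMulVec, vecMulVec_eq Unit, det_add_replicateCol_mul_replicateRow hM,
    det_unique (n := Unit), Matrix.add_apply, one_apply_eq, Matrix.mul_assoc, ← replicateCol_mulVec,
    replicateRow_mul_replicateCol_apply, mulVec_neg, dotProduct_neg, sub_eq_add_neg]

theorem numTilingsContaining_eq (hxy : -(b : ℤ) ≤ y - x) (hyx : y - x < c) :
    (numTilingsContaining a b c x y : ℚ) = (pathMatrix a b c).det *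
      (endVector a c x y ⬝ᵥ ((pathMatrix a b c)⁻¹ *ᵥ startVector a b x y)) := by
  have hcard := congrArg (Nat.cast (R := ℚ)) <|
    card_filter_add_card_filter_not (s := tilings a b c) fun T => horizontalRhombus x y ∈ T
  rw [Nat.cast_add, card_tilings_not_mem hxy hyx, card_tilings,
    det_sub_vecMulVec (isUnit_det_pathMatrix a b c)] at hcard
  rw [numTilingsContaining]
  linarith

theorem numTilingsContaining_eq_zero (h : y - x < -b ∨ c ≤ y - x) :
    numTilingsContaining a b c x y = 0 := by
  rw [numTilingsContaining, card_eq_zero, filter_false_of_mem]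
  intro T hT hxy
  have hmem := pair_mem_hexagonRhombi.1 ((mem_tilings_iff.1 hT).1 hxy)
  have := mem_hexagonTriangles_true.1 hmem.2.1
  omega

end Counting

section Formula

variable {a b c n x₀ : ℕ} {x y : ℤ}

theorem pathMatrix_mulVec_binom (h : x₀ + n < a) :
    (pathMatrix a b c *ᵥ fun j => (binom n ((j : ℕ) - x₀) : ℚ)) =
      fun i : Fin a => (binom ((b : ℤ) + c + n) ((b : ℤ) + (i : ℕ) - x₀) : ℚ) := by
  funext i
  rw [← sum_binom_mul_binom_sub h]
  simp only [mulVec, dotProduct, pathMatrix, of_apply, mul_comm]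

theorem binom_vecMul_pathMatrix (h : x₀ + n < a) :
    (fun i : Fin a => (binom n ((i : ℕ) - x₀) : ℚ)) ᵥ* pathMatrix a b c =
      fun j : Fin a => (binom ((b : ℤ) + c + n) ((b : ℤ) - (j : ℕ) + x₀ + n) : ℚ) := by
  funext j
  rw [← sum_binom_mul_binom_add h]
  simp only [vecMul, dotProduct, pathMatrix, of_apply, add_sub_right_comm]

theorem dotProduct_eq_zero_of_le_sub (hy : y ≤ c + a - 1) (h : c ≤ y - x) :
    endVector a c x y ⬝ᵥ ((pathMatrix a b c)⁻¹ *ᵥ startVector a b x y) = 0 := by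
  rcases le_or_gt x 0 with hx | hx
  · have hend : endVector a c x y = 0 := funext fun j => by
      rw [endVector, binom_of_neg _ (by omega), Int.cast_zero, Pi.zero_apply]
    rw [hend, zero_dotProduct]
  lift x to ℕ using hx.le
  obtain ⟨n, rfl⟩ : ∃ n : ℕ, y = c + x + n := ⟨(y - c - x).toNat, by omega⟩
  have hstart : startVector a b x (c + x + n) =
      pathMatrix a b c *ᵥ fun j => (binom n ((j : ℕ) - x) : ℚ) := by
    rw [pathMatrix_mulVec_binom (show x + n < a by omega)]
    funext i
    rw [startVector, show (b : ℤ) + (c + x + n) - x = b + c + n by ring, sub_add_eq_add_sub]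
  rw [hstart, mulVec_mulVec, nonsing_inv_mul _ (isUnit_det_pathMatrix a b c), one_mulVec]
  refine sum_eq_zero fun j _ => ?_
  rcases lt_or_ge ((j : ℕ) : ℤ) x with hj | hj
  · dsimp only
    rw [binom_of_neg _ (by omega), Int.cast_zero, mul_zero]
  · rw [endVector, binom_of_neg _ (by omega), Int.cast_zero, zero_mul]

theorem dotProduct_eq_zero_of_sub_lt (hy : 0 ≤ y) (h : y - x < -b) :
    endVector a c x y ⬝ᵥ ((pathMatrix a b c)⁻¹ *ᵥ startVector a b x y) = 0 := by
  rcases le_or_gt (a + b : ℤ) x with hx | hx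
  · have hstart : startVector a b x y = 0 := funext fun i => by
      rw [startVector, binom_of_neg _ (by omega), Int.cast_zero, Pi.zero_apply]
    rw [hstart, mulVec_zero, dotProduct_zero]
  lift y to ℕ using hy
  obtain ⟨n, rfl⟩ : ∃ n : ℕ, x = b + y + 1 + n := ⟨(x - b - y - 1).toNat, by omega⟩
  have hend : endVector a c (b + y + 1 + n) y =
      (fun i : Fin a => (binom n ((i : ℕ) - y) : ℚ)) ᵥ* pathMatrix a b c := by
    rw [binom_vecMul_pathMatrix (show y + n < a by omega)]
    funext j
    rw [endVector, show (c : ℤ) + (b + y + 1 + n) - y - 1 = b + c + n by ring,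
      show (b : ℤ) + y + 1 + n - 1 - (j : ℕ) = b - (j : ℕ) + y + n by ring]
  rw [hend, ← dotProduct_mulVec, mulVec_mulVec, mul_nonsing_inv _ (isUnit_det_pathMatrix a b c),
    one_mulVec]
  refine sum_eq_zero fun i _ => ?_
  rcases lt_or_ge ((i : ℕ) : ℤ) (y + n + 1) with hi | hi
  · rw [startVector, binom_of_neg _ (by omega), Int.cast_zero, mul_zero]
  · dsimp only
    rw [binom_of_lt (by omega), Int.cast_zero, zero_mul]

theorem numTilingsContaining_eq_det_mul (hy₀ : 0 ≤ y) (hy₁ : y ≤ c + a - 1) :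
    (numTilingsContaining a b c x y : ℚ) = (pathMatrix a b c).det *
      (endVector a c x y ⬝ᵥ ((pathMatrix a b c)⁻¹ *ᵥ startVector a b x y)) := by
  rcases lt_or_ge (y - x) (-b : ℤ) with hxy | hxy
  · rw [numTilingsContaining_eq_zero (Or.inl hxy), dotProduct_eq_zero_of_sub_lt hy₀ hxy, mul_zero,
      Nat.cast_zero]
  rcases lt_or_ge (y - x) (c : ℤ) with hyx | hyx
  · exact numTilingsContaining_eq hxy hyx
  · rw [numTilingsContaining_eq_zero (Or.inr hyx), dotProduct_eq_zero_of_le_sub hy₁ hyx, mul_zero,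
      Nat.cast_zero]

theorem pascalMatrix_mulVec_startVector :
    pascalMatrix a *ᵥ startVector a b x y = fun s : Fin a =>
      (binom ((b : ℤ) + y - x + (s : ℕ)) ((b : ℤ) - x + (s : ℕ)) : ℚ) :=
  funext fun s => pascalMatrix_mulVec_binom_add _ _ s

theorem pascalMatrix_mulVec_endVector :
    pascalMatrix a *ᵥ endVector a c x y = fun n : Fin a =>
      (binom ((c : ℤ) + x - y - 1 + (n : ℕ)) (x - 1) : ℚ) :=
  funext fun n => pascalMatrix_mulVec_binom_sub _ _ n

/-- The summand of the triple sum in the formula for `numTilingsContaining a b c x y`; the indices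
`n`, `m`, `s` are counted from `1`. -/
noncomputable def formulaSummand (b c : ℕ) (x y : ℤ) (n m s : ℕ) : ℚ :=
  (-1 : ℚ) ^ (n + s) *
    (binom ((c : ℤ) + x - y + n - 2) (x - 1) : ℚ) *
    (binom ((b : ℤ) - x + y + s - 1) ((b : ℤ) - x + s - 1) : ℚ) *
    (poch ((b : ℚ) + 1) (s - 1) / poch ((b : ℚ) + c + 1) (s - 1)) *
    ((m - 1).choose (s - 1) : ℚ) *
    (poch ((c : ℚ) + 1) (n - 1) / ((n - 1).factorial : ℚ)) *
    pochDivFactorial ((b : ℚ) + c + n) ((m : ℤ) - n)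

theorem sum_Icc_formulaSummand (n m : ℕ) (hm : m ∈ Icc 1 a) :
    ∑ s ∈ Icc 1 m, formulaSummand b c x y n m s = ∑ s ∈ Icc 1 a, formulaSummand b c x y n m s := by
  rw [mem_Icc] at hm
  refine sum_subset (Icc_subset_Icc_right hm.2) fun s hs hs' => ?_
  rw [mem_Icc] at hs hs'
  rw [formulaSummand, Nat.choose_eq_zero_of_lt (show m - 1 < s - 1 by omega)]
  simp

theorem sum_formulaSummand_eq_dotProduct (a b c : ℕ) (x y : ℤ) :
    ∑ n ∈ Icc 1 a, ∑ m ∈ Icc 1 a, ∑ s ∈ Icc 1 m, formulaSummand b c x y n m s =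
      (rightFactor a b c *ᵥ (pascalMatrix a *ᵥ endVector a c x y)) ⬝ᵥ
        (leftFactor a b c *ᵥ (pascalMatrix a *ᵥ startVector a b x y)) := by
  rw [pascalMatrix_mulVec_startVector, pascalMatrix_mulVec_endVector,
    sum_congr rfl fun n _ => sum_congr rfl (sum_Icc_formulaSummand n), sum_comm]
  simp only [sum_Icc_eq_sum_fin, dotProduct, mulVec, leftFactor, rightFactor, of_apply, sum_mul_sum]
  refine sum_congr rfl fun m _ => sum_congr rfl fun n _ => sum_congr rfl fun s _ => ?_
  rw [formulaSummand]
  simp only [Nat.add_sub_cancel]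
  push_cast
  rw [show (c : ℤ) + x - y + ((n : ℕ) + 1) - 2 = c + x - y - 1 + (n : ℕ) by ring,
    show (b : ℤ) - x + y + ((s : ℕ) + 1) - 1 = b + y - x + (s : ℕ) by ring,
    show (b : ℤ) - x + ((s : ℕ) + 1) - 1 = b - x + (s : ℕ) by ring,
    show ((m : ℕ) : ℤ) + 1 - ((n : ℕ) + 1) = (m : ℕ) - (n : ℕ) by ring, ← add_assoc]
  ring_nf

end Formula

end RhombusTiling

theorem mainTheorem5_general (a b c : ℕ) (x y : ℤ) (hy₀ : 0 ≤ y) (hy₁ : y ≤ (c : ℤ) + a - 1) :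
    (RhombusTiling.numTilingsContaining a b c x y : ℚ) =
      (∏ i ∈ Finset.Icc 1 a, ∏ j ∈ Finset.Icc 1 b, ∏ k ∈ Finset.Icc 1 c,
          ((i : ℚ) + (j : ℚ) + (k : ℚ) - 1) / ((i : ℚ) + (j : ℚ) + (k : ℚ) - 2)) *
        (RhombusTiling.poch 1 c / RhombusTiling.poch ((b : ℚ) + 1) c) *
        ∑ n ∈ Finset.Icc 1 a, ∑ m ∈ Finset.Icc 1 a, ∑ s ∈ Finset.Icc 1 m,
          (-1 : ℚ) ^ (n + s) *
            (RhombusTiling.binom ((c : ℤ) + x - y + n - 2) (x - 1) : ℚ) *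
            (RhombusTiling.binom ((b : ℤ) - x + y + s - 1) ((b : ℤ) - x + s - 1) : ℚ) *
            (RhombusTiling.poch ((b : ℚ) + 1) (s - 1) /
              RhombusTiling.poch ((b : ℚ) + c + 1) (s - 1)) *
            ((m - 1).choose (s - 1) : ℚ) *
            (RhombusTiling.poch ((c : ℚ) + 1) (n - 1) / ((n - 1).factorial : ℚ)) *
            RhombusTiling.pochDivFactorial ((b : ℚ) + c + n) ((m : ℤ) - n) := by
  rw [RhombusTiling.prod_box_eq_det_pathMatrix, RhombusTiling.poch_one_div_poch,
    RhombusTiling.numTilingsContaining_eq_det_mul hy₀ hy₁,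
    RhombusTiling.dotProduct_inv_pathMatrix_mulVec,
    ← RhombusTiling.sum_formulaSummand_eq_dotProduct, mul_assoc]
  rfl

theorem mainTheorem5 (a b c : ℕ) (ha : 0 < a) (hb : 0 < b) (hc : 0 < c)
    (x y : ℤ) (hx₀ : 0 ≤ x) (hx₁ : x ≤ (b : ℤ) + a - 1)
    (hy₀ : 1 ≤ y) (hy₁ : y ≤ (c : ℤ) + a - 1) :
    (RhombusTiling.numTilingsContaining a b c x y : ℚ) =
      (∏ i ∈ Finset.Icc 1 a, ∏ j ∈ Finset.Icc 1 b, ∏ k ∈ Finset.Icc 1 c,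
          ((i : ℚ) + (j : ℚ) + (k : ℚ) - 1) / ((i : ℚ) + (j : ℚ) + (k : ℚ) - 2)) *
        (RhombusTiling.poch 1 c / RhombusTiling.poch ((b : ℚ) + 1) c) *
        ∑ n ∈ Finset.Icc 1 a, ∑ m ∈ Finset.Icc 1 a, ∑ s ∈ Finset.Icc 1 m,
          (-1 : ℚ) ^ (n + s) *
            (RhombusTiling.binom ((c : ℤ) + x - y + n - 2) (x - 1) : ℚ) *
            (RhombusTiling.binom ((b : ℤ) - x + y + s - 1) ((b : ℤ) - x + s - 1) : ℚ) *
            (RhombusTiling.poch ((b : ℚ) + 1) (s - 1) /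
              RhombusTiling.poch ((b : ℚ) + c + 1) (s - 1)) *
            ((m - 1).choose (s - 1) : ℚ) *
            (RhombusTiling.poch ((c : ℚ) + 1) (n - 1) / ((n - 1).factorial : ℚ)) *
            RhombusTiling.pochDivFactorial ((b : ℚ) + c + n) ((m : ℤ) - n) :=
  mainTheorem5_general a b c x y (by omega) hy₁
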